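/- **Setting.** There are $n\ge 1$ agents with local costs $f_i:\mathbb{R}^p\times\mathbb{R}^q\to\mathbb{R}$ and local learning functions $h_i:\mathbb{R}^q\to\mathbb{R}$. Let $\theta_*$ minimize $\frac1n\sum_i h_i$ and let $x_*$ minimize $\frac1n\sum_i f_i(\cdot,\theta_*)$. Starting from deterministic points $x_i(0),\theta_i(0)$, the coupled distributed stochastic approximation algorithm iterates $$x_i(k+1)=\sum_{j=1}^n w_{ij}\bigl(x_j(k)-\alpha_k\, g_j(x_j(k),\theta_j(k),\xi_j(k))\bigr),\qquad \theta_i(k+1)=\sum_{j=1}^n w_{ij}\bigl(\theta_j(k)-\gamma_k\, \phi_j(\theta_j(k),\zeta_j(k))\bigr),$$ where the oracles $g_i,\phi_i$ are measurable and the samples $\xi_i(k)\in\mathbb{R}^d$, $\zeta_i(k)\in\mathbb{R}^m$ are random vectors on a probability space. Let $\mathcal F(k)$ be the $\sigma$-algebra generated by all $x_i(j),\theta_i(j)$ with $j\le k$. For every $k$, the $\xi_i(k)$, $1\le i\le n$, are mutually independent and jointly independent of $\mathcal F(k)$, and likewise the $\zeta_i(k)$. **Assumptions** (all constants are positive). 1.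 $f_i(\cdot,\theta)$ and $h_i$ are differentiable and, for all $i$ and all arguments, $\langle\nabla_x f_i(x',\theta)-\nabla_x f_i(x,\theta),x'-x\rangle\ge\mu_x\|x'-x\|^2$, $\ \|\nabla_x f_i(x',\theta)-\nabla_x f_i(x,\theta)\|\le L_x\|x'-x\|$, $\ \|\nabla_x f_i(x,\theta')-\nabla_x f_i(x,\theta)\|\le L_{x\theta}\|\theta'-\theta\|$, $\ \langle\nabla h_i(\theta')-\nabla h_i(\theta),\theta'-\theta\rangle\ge\mu_\theta\|\theta'-\theta\|^2$, $\ \|\nabla h_i(\theta')-\nabla h_i(\theta)\|\le L_\theta\|\theta'-\theta\|$. 2. The stochastic gradients $g_i(k)=g_i(x_i(k),\theta_i(k),\xi_i(k))$ and $\phi_i(k)=\phi_i(\theta_i(k),\zeta_i(k))$ are square integrable and, almost surely for all $i,k$, $\mathbb E[g_i(k)\mid\mathcal F(k)]=\nabla_x f_i(x_i(k),\theta_i(k))$, $\ \mathbb E[\phi_i(k)\mid\mathcal F(k)]=\nabla h_i(\theta_i(k))$, $\ \mathbb E[\|g_i(k)-\nabla_xf_i(x_i(k),\theta_i(k))\|^2\mid\mathcal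 F(k)]\le\sigma_x^2+M_x\|\nabla_xf_i(x_i(k),\theta_i(k))\|^2$, $\ \mathbb E[\|\phi_i(k)-\nabla h_i(\theta_i(k))\|^2\mid\mathcal F(k)]\le\sigma_\theta^2+M_\theta\|\nabla h_i(\theta_i(k))\|^2$. 3. $W=(w_{ij})$ is nonnegative and doubly stochastic; for $i\ne j$, $w_{ij}>0$ if and only if $i,j$ are adjacent in a fixed connected undirected graph on the agents; and $\rho_w<1$, where $\rho_w$ is the spectral norm of $W-\frac1n\mathbf 1\mathbf 1^T$. 4. $\alpha_k=\frac{\beta}{\mu_x(k+K)}$ and $\gamma_k=\frac{\beta}{\mu_\theta(k+K)}$ with $\beta>2$ and $K=\Bigl\lceil\max\Bigl\{\frac{3\beta(1+M_x)L_x^2}{\mu_x^2},\frac{3\beta(1+M_\theta)L_\theta^2}{\mu_\theta^2}\Bigr\}\Bigr\rceil$. 5. Each of $\sum_i\|x_i(0)-x_*\|^2$, $\sum_i\|\theta_i(0)-\theta_*\|^2$, $\sum_i\|\nabla_xf_i(x_*,\theta_*)\|^2$, $\sum_i\|\nabla h_i(\theta_*)\|^2$ is at most $Bn$. Put $\bar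 M=\frac{3M_x}{n}\sum_{i=1}^n\|\nabla_xf_i(x_*,\theta_*)\|^2+\sigma_x^2$. **Theorem.** There are constants $C_T,C_1>0$ depending only on $\mu_x,L_x,L_{x\theta},\mu_\theta,L_\theta,\sigma_x,M_x,\sigma_\theta,M_\theta,\beta,B$ (and not on $n$, the dimensions, the network, the functions, the samples or $k$) such that in every such setting there is a transient time $K_T\in\mathbb N$, $K_T\ge1$, with $$K_T\le C_T\,\frac{n}{(1-\rho_w)^2}$$ and, for all $k\ge K_T$, the errors $\|x_i(k)-x_*\|^2$ are integrable and $$\frac1n\sum_{i=1}^n\mathbb E\|x_i(k)-x_*\|^2\le C_1\,\frac{\beta^2\bar M}{(2\beta-1)\,n\,\mu_x^2\,k}.$$ -/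

import Mathlib

open MeasureTheory ProbabilityTheory

noncomputable section

namespace CDSA

/-- The Euclidean space `ℝᵖ` with its `ℓ²` norm. -/
abbrev Vec (p : ℕ) : Type := EuclideanSpace ℝ (Fin p)

/-- The numerical constants of the problem class: strong convexity and smoothness constants
`muX`, `LX` of `x ↦ f_i(x,θ)`; the Lipschitz constant `LXT` of `θ ↦ ∇ₓ f_i(x,θ)`; strong convexity
and smoothness constants `muT`, `LT` of the learning functions `h_i`; the noise constants
`σ_x, M_x, σ_θ, M_θ`; and the stepsize parameter `β`. -/
structure Constants where
  muX : ℝ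
  LX : ℝ
  LXT : ℝ
  muT : ℝ
  LT : ℝ
  sigX : ℝ
  MX : ℝ
  sigT : ℝ
  MT : ℝ
  beta : ℝ

/-- All constants are positive and `β > 2`. -/
structure Constants.Admissible (c : Constants) : Prop where
  muX_pos : 0 < c.muX
  LX_pos : 0 < c.LX
  LXT_pos : 0 < c.LXT
  muT_pos : 0 < c.muT
  LT_pos : 0 < c.LT
  sigX_pos : 0 < c.sigX
  MX_pos : 0 < c.MX
  sigT_pos : 0 < c.sigT
  MT_pos : 0 < c.MT
  two_lt_beta : 2 < c.beta

/-- `K = ⌈max {3β(1+M_x)L_x²/μ_x², 3β(1+M_θ)L_θ²/μ_θ²}⌉`. -/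
def Constants.shift (c : Constants) : ℕ :=
  ⌈max (3 * c.beta * (1 + c.MX) * c.LX ^ 2 / c.muX ^ 2)
    (3 * c.beta * (1 + c.MT) * c.LT ^ 2 / c.muT ^ 2)⌉₊

/-- The stepsize `α_k = β / (μ_x (k + K))` of the decision variables. -/
def Constants.stepX (c : Constants) (k : ℕ) : ℝ := c.beta / (c.muX * ((k : ℝ) + c.shift))

/-- The stepsize `γ_k = β / (μ_θ (k + K))` of the parameters. -/
def Constants.stepT (c : Constants) (k : ℕ) : ℝ := c.beta / (c.muT * ((k : ℝ) + c.shift))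

/-- The data of the coupled problem with `n` agents on a sample space `Ω`: local costs `f i`,
local learning functions `h i`, stochastic first-order oracles `g i` and `φ i` for `∇ₓ f i` and
`∇ h i`, the samples `ξ i k`, `ζ i k` that agent `i` draws at step `k`, the (deterministic) initial
points, the communication graph `G` and the weight matrix `W`. -/
structure Data (n p q d m : ℕ) (Ω : Type*) where
  f : Fin n → Vec p → Vec q → ℝ
  h : Fin n → Vec q → ℝ
  g : Fin n → Vec p → Vec q → Vec d → Vec p
  φ : Fin n → Vec q → Vec m → Vec q
  ξ : Fin n → ℕ → Ω → Vec d
  ζ : Fin n → ℕ → Ω → Vec m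
  x₀ : Fin n → Vec p
  θ₀ : Fin n → Vec q
  G : SimpleGraph (Fin n)
  W : Matrix (Fin n) (Fin n) ℝ

variable {n p q d m : ℕ} {Ω : Type*}

namespace Data

/-- `∇ₓ f_i(x, θ)`. -/
def gradF (D : Data n p q d m Ω) (i : Fin n) (x : Vec p) (θ : Vec q) : Vec p :=
  gradient (fun y => D.f i y θ) x

/-- `∇ h_i(θ)`. -/
def gradH (D : Data n p q d m Ω) (i : Fin n) (θ : Vec q) : Vec q :=
  gradient (D.h i) θ

/-- The pair `(x(k), θ(k))` of all agents' iterates of the algorithm: a stochastic gradient step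
at every agent, followed by averaging with the weights `W`. -/
def iter (D : Data n p q d m Ω) (c : Constants) :
    ℕ → Ω → (Fin n → Vec p) × (Fin n → Vec q)
  | 0, _ => (D.x₀, D.θ₀)
  | k + 1, ω =>
    (fun i => ∑ j, D.W i j • ((iter D c k ω).1 j -
        c.stepX k • D.g j ((iter D c k ω).1 j) ((iter D c k ω).2 j) (D.ξ j k ω)),
     fun i => ∑ j, D.W i j • ((iter D c k ω).2 j -
        c.stepT k • D.φ j ((iter D c k ω).2 j) (D.ζ j k ω)))

/-- `x_i(k)`. -/
def x (D : Data n p q d m Ω) (c : Constants) (i : Fin n) (k : ℕ) (ω : Ω) : Vec p :=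
  (D.iter c k ω).1 i

/-- `θ_i(k)`. -/
def θ (D : Data n p q d m Ω) (c : Constants) (i : Fin n) (k : ℕ) (ω : Ω) : Vec q :=
  (D.iter c k ω).2 i

/-- The stochastic gradient `g_i(x_i(k), θ_i(k), ξ_i(k))`. -/
def stochX (D : Data n p q d m Ω) (c : Constants) (i : Fin n) (k : ℕ) (ω : Ω) : Vec p :=
  D.g i (D.x c i k ω) (D.θ c i k ω) (D.ξ i k ω)

/-- The stochastic gradient `φ_i(θ_i(k), ζ_i(k))`. -/
def stochT (D : Data n p q d m Ω) (c : Constants) (i : Fin n) (k : ℕ) (ω : Ω) : Vec q :=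
  D.φ i (D.θ c i k ω) (D.ζ i k ω)

/-- `F(k)`: the `σ`-algebra generated by `x_i(j), θ_i(j)` for all agents `i` and all `j ≤ k`. -/
@[reducible] def hist (D : Data n p q d m Ω) (c : Constants) (k : ℕ) : MeasurableSpace Ω :=
  ⨆ (j : ℕ) (_ : j ≤ k), MeasurableSpace.comap (D.iter c j) inferInstance

/-- `ρ_w`: the spectral norm of `W - 𝟏𝟏ᵀ/n`. -/
def rho (D : Data n p q d m Ω) : ℝ :=
  ‖Matrix.toEuclideanCLM (n := Fin n) (𝕜 := ℝ) (D.W - Matrix.of (fun _ _ => 1 / (n : ℝ)))‖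

/-- Function properties: `f_i(·,θ)` is `μ_x`-strongly convex with `L_x`-Lipschitz gradient,
`∇ₓ f_i(x,·)` is Lipschitz, and `h_i` is `μ_θ`-strongly convex with `L_θ`-Lipschitz gradient. -/
structure FunctionAssumption (D : Data n p q d m Ω) (c : Constants) : Prop where
  diff_f : ∀ i θ, Differentiable ℝ (fun x => D.f i x θ)
  strong_f : ∀ i θ x' x,
    c.muX * ‖x' - x‖ ^ 2 ≤ inner ℝ (D.gradF i x' θ - D.gradF i x θ) (x' - x)
  smooth_f : ∀ i θ x' x, ‖D.gradF i x' θ - D.gradF i x θ‖ ≤ c.LX * ‖x' - x‖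
  lip_f : ∀ i x θ' θ, ‖D.gradF i x θ' - D.gradF i x θ‖ ≤ c.LXT * ‖θ' - θ‖
  diff_h : ∀ i, Differentiable ℝ (D.h i)
  strong_h : ∀ i θ' θ,
    c.muT * ‖θ' - θ‖ ^ 2 ≤ inner ℝ (D.gradH i θ' - D.gradH i θ) (θ' - θ)
  smooth_h : ∀ i θ' θ, ‖D.gradH i θ' - D.gradH i θ‖ ≤ c.LT * ‖θ' - θ‖

/-- The samples are random vectors, the oracles are jointly measurable, and at every step the
fresh samples of the agents are mutually independent and jointly independent of the history. -/
structure SamplingAssumption [MeasurableSpace Ω] (D : Data n p q d m Ω) (c : Constants)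
    (P : Measure Ω) : Prop where
  meas_g : ∀ i, Measurable (fun z : Vec p × Vec q × Vec d => D.g i z.1 z.2.1 z.2.2)
  meas_φ : ∀ i, Measurable (fun z : Vec q × Vec m => D.φ i z.1 z.2)
  meas_ξ : ∀ i k, Measurable (D.ξ i k)
  meas_ζ : ∀ i k, Measurable (D.ζ i k)
  indep_ξ : ∀ k, iIndepFun (fun i => D.ξ i k) P
  indep_ζ : ∀ k, iIndepFun (fun i => D.ζ i k) P
  fresh_ξ : ∀ k, Indep (MeasurableSpace.comap (fun ω i => D.ξ i k ω) inferInstance)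
    (D.hist c k) P
  fresh_ζ : ∀ k, Indep (MeasurableSpace.comap (fun ω i => D.ζ i k ω) inferInstance)
    (D.hist c k) P

/-- Conditional first and second moments of the stochastic gradients. The first two fields say
that the stochastic gradients have finite second moments, so that the conditional expectations
below are the genuine ones. -/
structure MomentAssumption [MeasurableSpace Ω] (D : Data n p q d m Ω) (c : Constants)
    (P : Measure Ω) : Prop where
  memLp_x : ∀ i k, MemLp (D.stochX c i k) 2 P
  memLp_t : ∀ i k, MemLp (D.stochT c i k) 2 P
  unbiased_x : ∀ i k, condExp (D.hist c k) P (D.stochX c i k) =ᵐ[P]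
    fun ω => D.gradF i (D.x c i k ω) (D.θ c i k ω)
  unbiased_t : ∀ i k, condExp (D.hist c k) P (D.stochT c i k) =ᵐ[P]
    fun ω => D.gradH i (D.θ c i k ω)
  variance_x : ∀ i k,
    condExp (D.hist c k) P
      (fun ω => ‖D.stochX c i k ω - D.gradF i (D.x c i k ω) (D.θ c i k ω)‖ ^ 2) ≤ᵐ[P]
    fun ω => c.sigX ^ 2 + c.MX * ‖D.gradF i (D.x c i k ω) (D.θ c i k ω)‖ ^ 2
  variance_t : ∀ i k,
    condExp (D.hist c k) P
      (fun ω => ‖D.stochT c i k ω - D.gradH i (D.θ c i k ω)‖ ^ 2) ≤ᵐ[P]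
    fun ω => c.sigT ^ 2 + c.MT * ‖D.gradH i (D.θ c i k ω)‖ ^ 2

/-- Graph and weight matrix: a connected undirected graph, and a nonnegative doubly stochastic
matrix whose off-diagonal support is the edge set. -/
structure NetworkAssumption (D : Data n p q d m Ω) : Prop where
  connected : D.G.Connected
  support : ∀ i j, i ≠ j → (0 < D.W i j ↔ D.G.Adj i j)
  nonneg : ∀ i j, 0 ≤ D.W i j
  row_sum : ∀ i, ∑ j, D.W i j = 1
  col_sum : ∀ j, ∑ i, D.W i j = 1

/-- `θ_*` minimizes `h = (1/n) ∑ h_i` and `x_*` minimizes `f(·, θ_*) = (1/n) ∑ f_i(·, θ_*)`. -/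
structure IsOptimal (D : Data n p q d m Ω) (xs : Vec p) (θs : Vec q) : Prop where
  min_h : ∀ θ, (1 / (n : ℝ)) * ∑ i, D.h i θs ≤ (1 / (n : ℝ)) * ∑ i, D.h i θ
  min_f : ∀ x, (1 / (n : ℝ)) * ∑ i, D.f i xs θs ≤ (1 / (n : ℝ)) * ∑ i, D.f i x θs

/-- The initial errors `A₁, A₂` and the heterogeneity measures `B₁, B₂` are at most `B * n`. -/
structure LinearBounds (D : Data n p q d m Ω) (xs : Vec p) (θs : Vec q) (B : ℝ) : Prop where
  init_x : ∑ i, ‖D.x₀ i - xs‖ ^ 2 ≤ B * n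
  init_t : ∑ i, ‖D.θ₀ i - θs‖ ^ 2 ≤ B * n
  heter_x : ∑ i, ‖D.gradF i xs θs‖ ^ 2 ≤ B * n
  heter_t : ∑ i, ‖D.gradH i θs‖ ^ 2 ≤ B * n

/-- `M̄ = 3 M_x ∑ ‖∇ₓ f_i(x_*,θ_*)‖² / n + σ_x²`. -/
def Mbar (D : Data n p q d m Ω) (c : Constants) (xs : Vec p) (θs : Vec q) : ℝ :=
  3 * c.MX * (∑ i, ‖D.gradF i xs θs‖ ^ 2) / n + c.sigX ^ 2

/-- The mean-squared error `(1/n) ∑ E‖x_i(k) - x_*‖²`. -/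
def mse [MeasurableSpace Ω] (D : Data n p q d m Ω) (c : Constants) (P : Measure Ω)
    (xs : Vec p) (k : ℕ) : ℝ :=
  (1 / (n : ℝ)) * ∑ i, ∫ ω, ‖D.x c i k ω - xs‖ ^ 2 ∂P

/-- The centralized rate `β² M̄ / ((2β-1) n μ_x² k)`. -/
def rate (D : Data n p q d m Ω) (c : Constants) (xs : Vec p) (θs : Vec q) (k : ℕ) : ℝ :=
  c.beta ^ 2 * D.Mbar c xs θs / ((2 * c.beta - 1) * n * c.muX ^ 2 * k)

end Data

end CDSA

end

/-!
The proof separates probability from analysis. Square integrable random vectors form the Hilbert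
space `L²(P; ℝᵖ)`, where a stochastic step of the algorithm is a deterministic recursion driven by
noise that is orthogonal to everything determined by the past and orthogonal between agents
(`IsNoisyStep`), and where the gradients act as strongly monotone Lipschitz superposition operators
(`IsGradField.isGradField_superpose`). The orthogonality to the past is unbiasedness
(`integral_inner_eq_zero_of_condExp`); the orthogonality between agents comes from the independence
of the fresh samples by Fubini's theorem (`integral_inner_oracle_eq_zero`).

Write `s = k + K`, so that the stepsize is `β / (μ s)`, and `δ = 1 - ρ_w`. In the Hilbert space three
quantities are followed, each normalised by `1 / n` and each bounded by constants that do not see the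
network:
* the mean squared error contracts up to a bounded perturbation (`IsNoisyStep.sum_sq_le`), hence
  stays bounded, and with it the gradients and the noise;
* the consensus error contracts by `1 - δ` and is driven by `1 / (δ s²)`
  (`IsNoisyStep.consensus_le`), hence is at most of order `1 / (s² δ²)`
  (`le_inv_sq_of_contraction`);
* the squared error of the average contracts by `1 - β / s` and is driven by `1 / (n s²)`, the averaged
  noise, plus `1 / s` times the consensus error and the parameter error (`IsNoisyStep.mean_le`).
  As `β > 2`, it is of order `1 / (n s) + 1 / (s² δ²)` (`le_inv_add_inv_sq_of_contraction`).

So the error is of order `1 / (n s) + 1 / (s² δ²)` provided that the parameter error is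
(`exists_rate`). The recursion for `θ` is of the same kind without a parameter, so the result is used
twice: for `θ`, and then for `x` with parameter `θ`. As soon as `k ≥ n / δ²` the second term is
dominated by `1 / (n k)`, which is the centralized rate because `M̄ ≥ σ_x² > 0`.
-/

namespace CDSA

/-! ### Real sequences driven by stepsizes `β / s` -/

theorem le_of_contraction {u t : ℕ → ℝ} {C : ℝ} (ht₁ : ∀ k, t k ≤ 1)
    (h₀ : u 0 ≤ C) (h : ∀ k, u (k + 1) ≤ (1 - t k) * u k + t k * C) (k : ℕ) : u k ≤ C := by
  induction k with
  | zero => exact h₀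
  | succ k ih => nlinarith [h k, ht₁ k]

/-- A bounded sequence that contracts by `1 - δ` and is driven by `C / (δ s²)` is of order
`1 / (s² δ²)` from the start: while `s ≤ 4 / δ` the mere bound `C` says so, and afterwards
the contraction beats the decrease of `1 / s²`. -/
theorem le_inv_sq_of_contraction {v : ℕ → ℝ} {K δ C : ℝ} (hK : 1 ≤ K) (hδ₀ : 0 < δ) (hδ₁ : δ ≤ 1)
    (hC : 0 ≤ C) (hv : ∀ k, v k ≤ C)
    (h : ∀ k : ℕ, v (k + 1) ≤ (1 - δ) * v k + C / (δ * (k + K) ^ 2)) (k : ℕ) :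
    v k ≤ (25 + K ^ 2) * C / ((k + K) ^ 2 * δ ^ 2) := by
  induction k with
  | zero =>
    refine (hv 0).trans ?_
    rw [le_div_iff₀ (by positivity)]
    have : δ ^ 2 ≤ 1 := pow_le_one₀ hδ₀.le hδ₁
    push_cast
    rw [zero_add]
    nlinarith [mul_le_mul_of_nonneg_left this (by positivity : 0 ≤ C * K ^ 2)]
  | succ k ih =>
    obtain ⟨s, hs⟩ : ∃ s : ℝ, s = k + K := ⟨_, rfl⟩
    have hs1 : 1 ≤ s := by rw [hs]; linarith [Nat.cast_nonneg (α := ℝ) k]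
    have e : ((k + 1 : ℕ) : ℝ) + K = s + 1 := by rw [hs]; push_cast; ring
    have hk := h k
    rw [e]
    rw [← hs] at ih hk
    set A : ℝ := 25 + K ^ 2 with hA
    have hA25 : 25 ≤ A := by rw [hA]; nlinarith [sq_nonneg K]
    by_cases hsδ : s * δ ≤ 4
    · refine (hv _).trans ?_
      rw [le_div_iff₀ (by positivity)]
      have h5 : (s + 1) ^ 2 * δ ^ 2 ≤ 25 := by
        have : (s + 1) * δ ≤ 5 := by linarith
        have h0 : 0 ≤ (s + 1) * δ := by positivity
        nlinarith
      nlinarith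
    · push Not at hsδ
      calc v (k + 1) ≤ (1 - δ) * (A * C / (s ^ 2 * δ ^ 2)) + C / (δ * s ^ 2) := by
            refine hk.trans ?_
            gcongr
        _ = C / δ ^ 2 * (((1 - δ) * A + δ) / s ^ 2) := by field_simp
        _ ≤ C / δ ^ 2 * (A / (s + 1) ^ 2) := by
            refine mul_le_mul_of_nonneg_left ?_ (by positivity)
            rw [div_le_div_iff₀ (by positivity) (by positivity)]
            have h1 : (1 - δ) * A + δ ≤ A * (1 - 7 / 8 * δ) := by nlinarith
            have h2 : (s + 1) ^ 2 ≤ s ^ 2 * (1 + 9 / 16 * δ) := by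
              nlinarith [mul_nonneg hδ₀.le (sub_nonneg.2 hδ₁), sq_nonneg s, hsδ.le, hs1,
                mul_le_mul_of_nonneg_left hsδ.le (by linarith : 0 ≤ s)]
            have h3 : (1 - 7 / 8 * δ) * (1 + 9 / 16 * δ) ≤ 1 := by nlinarith
            calc ((1 - δ) * A + δ) * (s + 1) ^ 2
                ≤ (A * (1 - 7 / 8 * δ)) * (s ^ 2 * (1 + 9 / 16 * δ)) := by
                  apply mul_le_mul h1 h2 (by positivity)
                  have : 0 ≤ 1 - 7 / 8 * δ := by linarith
                  positivity
              _ = A * s ^ 2 * ((1 - 7 / 8 * δ) * (1 + 9 / 16 * δ)) := by ring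
              _ ≤ A * s ^ 2 * 1 := by gcongr
              _ = A * s ^ 2 := by ring
        _ = A * C / ((s + 1) ^ 2 * δ ^ 2) := by field_simp

/-- Chung's lemma for a driving term with two orders: contraction by `1 - β / s` with `β > 2`
turns `a / s² + b / s³` into `A / s + b' / s²`. -/
theorem le_inv_add_inv_sq_of_contraction {r : ℕ → ℝ} {K β a b A A' : ℝ} (hβK : β ≤ K)
    (hβ : 2 < β) (ha : 0 ≤ a) (hb : 0 ≤ b)
    (hA : a ≤ (β - 1) * A) (hA' : b ≤ (β - 2) * A') (h₀ : r 0 ≤ A / K + A' / K ^ 2)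
    (h : ∀ k : ℕ, r (k + 1) ≤ (1 - β / (k + K)) * r k + a / (k + K) ^ 2 + b / (k + K) ^ 3) (k : ℕ) :
    r k ≤ A / (k + K) + A' / (k + K) ^ 2 := by
  have hA0 : 0 ≤ A := by by_contra hc; push Not at hc; nlinarith
  have hA0' : 0 ≤ A' := by by_contra hc; push Not at hc; nlinarith
  induction k with
  | zero => simpa using h₀
  | succ k ih =>
    obtain ⟨s, hs⟩ : ∃ s : ℝ, s = k + K := ⟨_, rfl⟩
    have hsK : K ≤ s := by rw [hs]; linarith [Nat.cast_nonneg (α := ℝ) k]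
    have hs0 : 0 < s := by linarith
    have e : ((k + 1 : ℕ) : ℝ) + K = s + 1 := by rw [hs]; push_cast; ring
    have hk := h k
    rw [e]
    rw [← hs] at ih hk
    have h1 : 1 / s - 1 / s ^ 2 ≤ 1 / (s + 1) := by
      rw [← sub_nonneg]
      have : 1 / (s + 1) - (1 / s - 1 / s ^ 2) = 1 / (s ^ 2 * (s + 1)) := by field_simp; ring
      rw [this]; positivity
    have h2 : 1 / s ^ 2 - 2 / s ^ 3 ≤ 1 / (s + 1) ^ 2 := by
      rw [← sub_nonneg]
      have : 1 / (s + 1) ^ 2 - (1 / s ^ 2 - 2 / s ^ 3) = (3 * s + 2) / (s ^ 3 * (s + 1) ^ 2) := by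
        field_simp; ring
      rw [this]; positivity
    have hc : 0 ≤ 1 - β / s := by rw [sub_nonneg, div_le_one hs0]; linarith
    calc r (k + 1) ≤ (1 - β / s) * (A / s + A' / s ^ 2) + a / s ^ 2 + b / s ^ 3 := by
          refine hk.trans ?_
          gcongr
      _ ≤ (1 - β / s) * (A / s + A' / s ^ 2) + (β - 1) * A / s ^ 2 + (β - 2) * A' / s ^ 3 := by
          gcongr
      _ = A * (1 / s - 1 / s ^ 2) + A' * (1 / s ^ 2 - 2 / s ^ 3) := by field_simp; ring
      _ ≤ A * (1 / (s + 1)) + A' * (1 / (s + 1) ^ 2) := by gcongr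
      _ = A / (s + 1) + A' / (s + 1) ^ 2 := by ring

/-! ### Averages and mixing of vectors in an inner product space -/

section

variable {n : ℕ} {H : Type*} [NormedAddCommGroup H] [InnerProductSpace ℝ H]

/-- The average of the vectors held by the `n` agents. -/
noncomputable def mean (v : Fin n → H) : H := (n : ℝ)⁻¹ • ∑ i, v i

/-- The vectors after one round of averaging with the weights `W`. -/
noncomputable def mix (W : Matrix (Fin n) (Fin n) ℝ) (v : Fin n → H) (i : Fin n) : H := ∑ j, W i j • v j

theorem card_smul_mean (hn : 1 ≤ n) (v : Fin n → H) : (n : ℝ) • mean v = ∑ i, v i := by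
  have : (n : ℝ) ≠ 0 := by positivity
  rw [mean, smul_smul, mul_inv_cancel₀ this, one_smul]

theorem mean_add (u v : Fin n → H) : mean (fun i => u i + v i) = mean u + mean v := by
  simp only [mean, Finset.sum_add_distrib, smul_add]

theorem mean_sub (u v : Fin n → H) : mean (fun i => u i - v i) = mean u - mean v := by
  simp only [mean, Finset.sum_sub_distrib, smul_sub]

theorem mean_smul (a : ℝ) (v : Fin n → H) : mean (fun i => a • v i) = a • mean v := by
  simp only [mean, ← Finset.smul_sum, smul_comm a]

theorem mean_const (hn : 1 ≤ n) (c : H) : mean (fun _ : Fin n => c) = c := by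
  have : (n : ℝ) ≠ 0 := by positivity
  simp only [mean, Finset.sum_const, Finset.card_univ, Fintype.card_fin]
  rw [← Nat.cast_smul_eq_nsmul ℝ, smul_smul, inv_mul_cancel₀ this, one_smul]

theorem inner_mean_right (x : H) (v : Fin n → H) :
    inner ℝ x (mean v) = (n : ℝ)⁻¹ * ∑ i, inner ℝ x (v i) := by
  rw [mean, real_inner_smul_right, inner_sum]

theorem inner_mean_left (x : H) (v : Fin n → H) :
    inner ℝ (mean v) x = (n : ℝ)⁻¹ * ∑ i, inner ℝ (v i) x := by
  rw [mean, real_inner_smul_left, sum_inner]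

theorem sum_norm_sub_mean_sq (hn : 1 ≤ n) (v : Fin n → H) :
    ∑ i, ‖v i - mean v‖ ^ 2 = ∑ i, ‖v i‖ ^ 2 - n * ‖mean v‖ ^ 2 := by
  simp only [norm_sub_sq_real, Finset.sum_add_distrib, Finset.sum_sub_distrib, ← Finset.mul_sum,
    ← sum_inner, ← card_smul_mean hn v, real_inner_smul_left, real_inner_self_eq_norm_sq,
    Finset.sum_const, Finset.card_univ, Fintype.card_fin, nsmul_eq_mul]
  ring

theorem norm_mean_sq_le (hn : 1 ≤ n) (v : Fin n → H) :
    ‖mean v‖ ^ 2 ≤ (∑ i, ‖v i‖ ^ 2) / n := by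
  have hn' : (0 : ℝ) < n := by positivity
  rw [le_div_iff₀ hn']
  have := sum_norm_sub_mean_sq hn v
  have h : 0 ≤ ∑ i, ‖v i - mean v‖ ^ 2 := by positivity
  linarith

theorem sum_norm_sub_mean_sq_le (hn : 1 ≤ n) (v : Fin n → H) :
    ∑ i, ‖v i - mean v‖ ^ 2 ≤ ∑ i, ‖v i‖ ^ 2 := by
  rw [sum_norm_sub_mean_sq hn v]
  have : 0 ≤ (n : ℝ) * ‖mean v‖ ^ 2 := by positivity
  linarith

/-- For pairwise orthogonal vectors averaging reduces the mean square by the factor `1 / n`. -/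
theorem norm_mean_sq_of_orthogonal (v : Fin n → H) (hv : ∀ i j, i ≠ j → inner ℝ (v i) (v j) = 0) :
    ‖mean v‖ ^ 2 = (∑ i, ‖v i‖ ^ 2) / n / n := by
  have : ‖∑ i, v i‖ ^ 2 = ∑ i, ‖v i‖ ^ 2 := by
    rw [← real_inner_self_eq_norm_sq, sum_inner]
    refine Finset.sum_congr rfl fun i _ => ?_
    rw [inner_sum, Finset.sum_eq_single i (fun j _ hj => hv i j hj.symm) (by simp),
      real_inner_self_eq_norm_sq]
  rw [mean, norm_smul, mul_pow, this, Real.norm_eq_abs, sq_abs, inv_pow]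
  ring

variable {W : Matrix (Fin n) (Fin n) ℝ}

theorem mean_mix (hcol : ∀ j, ∑ i, W i j = 1) (v : Fin n → H) : mean (mix W v) = mean v := by
  simp only [mean, mix]
  rw [Finset.sum_comm]
  simp only [← Finset.sum_smul, hcol, one_smul]

theorem mix_add (u v : Fin n → H) (i : Fin n) :
    mix W (fun j => u j + v j) i = mix W u i + mix W v i := by
  simp only [mix, smul_add, Finset.sum_add_distrib]

theorem mix_const (hrow : ∀ i, ∑ j, W i j = 1) (c : H) (i : Fin n) :
    mix W (fun _ => c) i = c := by
  simp only [mix, ← Finset.sum_smul, hrow, one_smul]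

/-- Jensen's inequality for averaging with a doubly stochastic matrix. -/
theorem sum_norm_mix_sq_le (hW : ∀ i j, 0 ≤ W i j) (hrow : ∀ i, ∑ j, W i j = 1)
    (hcol : ∀ j, ∑ i, W i j = 1) (v : Fin n → H) :
    ∑ i, ‖mix W v i‖ ^ 2 ≤ ∑ i, ‖v i‖ ^ 2 := by
  calc ∑ i, ‖mix W v i‖ ^ 2 ≤ ∑ i, ∑ j, W i j * ‖v j‖ ^ 2 := by
        refine Finset.sum_le_sum fun i _ => ?_
        have h1 : ‖mix W v i‖ ≤ ∑ j, W i j * ‖v j‖ := by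
          refine (norm_sum_le _ _).trans_eq (Finset.sum_congr rfl fun j _ => ?_)
          rw [norm_smul, Real.norm_of_nonneg (hW i j)]
        refine (pow_le_pow_left₀ (norm_nonneg _) h1 2).trans ?_
        simpa using (convexOn_pow 2).map_sum_le (t := Finset.univ) (w := W i)
          (p := fun j => ‖v j‖) (fun j _ => hW i j) (hrow i) (fun j _ => norm_nonneg _)
    _ = ∑ i, ‖v i‖ ^ 2 := by
        rw [Finset.sum_comm]
        simp only [← Finset.sum_mul, hcol, one_mul]

open scoped MatrixOrder in
/-- The spectral norm of a real matrix bounds its action on families of vectors of any real inner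
product space: `‖A‖² - AᵀA` is positive semidefinite, hence of the form `CᵀC`. -/
theorem sum_norm_mix_sq_le_opNorm (A : Matrix (Fin n) (Fin n) ℝ) (v : Fin n → H) :
    ∑ i, ‖mix A v i‖ ^ 2
      ≤ ‖Matrix.toEuclideanCLM (n := Fin n) (𝕜 := ℝ) A‖ ^ 2 * ∑ i, ‖v i‖ ^ 2 := by
  set ρ := ‖Matrix.toEuclideanCLM (n := Fin n) (𝕜 := ℝ) A‖ with hρ
  have key : ∀ (C : Matrix (Fin n) (Fin n) ℝ),
      ∑ i, ‖mix C v i‖ ^ 2 = ∑ i, ∑ j, (C.transpose * C) i j * inner ℝ (v i) (v j) := by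
    intro C
    simp only [← real_inner_self_eq_norm_sq, mix, sum_inner, inner_sum, real_inner_smul_left,
      real_inner_smul_right, Matrix.mul_apply, Matrix.transpose_apply, Finset.sum_mul]
    rw [Finset.sum_comm]
    refine Finset.sum_congr rfl fun i _ => ?_
    rw [Finset.sum_comm]
    exact Finset.sum_congr rfl fun j _ => Finset.sum_congr rfl fun l _ => by
      rw [real_inner_comm]; ring
  have hpsd : (ρ ^ 2 • (1 : Matrix (Fin n) (Fin n) ℝ) - A.transpose * A).PosSemidef := by
    refine Matrix.PosSemidef.of_dotProduct_mulVec_nonneg ?_ fun x => ?_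
    · simp [Matrix.IsHermitian, Matrix.transpose_mul,
        Matrix.conjTranspose_eq_transpose_of_trivial]
    · have h := (Matrix.toEuclideanCLM (n := Fin n) (𝕜 := ℝ) A).le_opNorm (WithLp.toLp 2 x)
      rw [← hρ] at h
      have h2 := pow_le_pow_left₀ (norm_nonneg _) h 2
      rw [mul_pow, EuclideanSpace.norm_sq_eq, EuclideanSpace.norm_sq_eq] at h2
      simp only [Matrix.toEuclideanCLM_toLp, Real.norm_eq_abs, sq_abs] at h2
      have e : star x ⬝ᵥ (ρ ^ 2 • (1 : Matrix (Fin n) (Fin n) ℝ) - A.transpose * A).mulVec x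
          = ρ ^ 2 * ∑ i, x i ^ 2 - ∑ i, (A.mulVec x) i ^ 2 := by
        rw [Matrix.sub_mulVec, dotProduct_sub, ← Matrix.mulVec_mulVec,
          Matrix.dotProduct_mulVec _ A.transpose, Matrix.vecMul_transpose]
        simp [dotProduct, Matrix.smul_mulVec, pow_two, Finset.mul_sum, mul_left_comm]
      rw [e]
      linarith
  obtain ⟨C, hC⟩ : ∃ C : Matrix (Fin n) (Fin n) ℝ,
      ρ ^ 2 • (1 : Matrix (Fin n) (Fin n) ℝ) - A.transpose * A = C.transpose * C := by
    obtain ⟨C, hC⟩ := CStarAlgebra.nonneg_iff_eq_star_mul_self.1 hpsd.nonneg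
    exact ⟨C, by simpa [Matrix.star_eq_conjTranspose,
      Matrix.conjTranspose_eq_transpose_of_trivial] using hC⟩
  have h0 : 0 ≤ ∑ i, ‖mix C v i‖ ^ 2 := by positivity
  rw [key C, ← hC] at h0
  rw [key A]
  simp only [Matrix.sub_apply, sub_mul, Finset.sum_sub_distrib, Matrix.smul_apply,
    Matrix.one_apply, smul_eq_mul, mul_ite, mul_one, mul_zero, ite_mul, zero_mul,
    Finset.sum_ite_eq, Finset.mem_univ, if_true, real_inner_self_eq_norm_sq,
    ← Finset.mul_sum] at h0
  linarith

/-- One round of averaging contracts the consensus error by the spectral norm of `W - 𝟏𝟏ᵀ/n`. -/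
theorem sum_norm_mix_sub_mean_sq_le (hn : 1 ≤ n) (hrow : ∀ i, ∑ j, W i j = 1) (v : Fin n → H) :
    ∑ i, ‖mix W v i - mean v‖ ^ 2
      ≤ ‖Matrix.toEuclideanCLM (n := Fin n) (𝕜 := ℝ) (W - Matrix.of fun _ _ => 1 / (n : ℝ))‖ ^ 2
        * ∑ i, ‖v i - mean v‖ ^ 2 := by
  refine le_trans (le_of_eq (Finset.sum_congr rfl fun i _ => ?_))
    (sum_norm_mix_sq_le_opNorm _ (fun i => v i - mean v))
  have h : mix W v i - mean v = mix W (fun i => v i - mean v) i := by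
    have := mix_add (W := W) (fun j => v j - mean v) (fun _ => mean v) i
    simp only [sub_add_cancel, mix_const hrow] at this
    exact sub_eq_iff_eq_add.2 this
  have h0 : ∑ j, (v j - mean v) = 0 := by
    rw [← card_smul_mean hn, mean_sub, mean_const hn, sub_self, smul_zero]
  rw [h]
  congr 2
  simp only [mix, Matrix.sub_apply, sub_smul, Finset.sum_sub_distrib (f := fun j => W i j • _),
    Matrix.of_apply, ← Finset.smul_sum, h0, smul_zero, sub_zero]

end

/-! ### Distributed stochastic gradient recursions in a Hilbert space -/

/-- Parametrised gradient fields on an inner product space: `Φ i · y` is `μ`-strongly monotone and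
`L`-Lipschitz, and `Φ i x ·` is `Λ`-Lipschitz. -/
structure IsGradField {n : ℕ} {H H' : Type*} [NormedAddCommGroup H] [InnerProductSpace ℝ H]
    [NormedAddCommGroup H'] (Φ : Fin n → H → H' → H) (μ L Λ : ℝ) : Prop where
  mono : ∀ i y x' x, μ * ‖x' - x‖ ^ 2 ≤ inner ℝ (Φ i x' y - Φ i x y) (x' - x)
  lip : ∀ i y x' x, ‖Φ i x' y - Φ i x y‖ ≤ L * ‖x' - x‖
  lip_param : ∀ i x y' y, ‖Φ i x y' - Φ i x y‖ ≤ Λ * ‖y' - y‖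

/-- A doubly stochastic weight matrix. -/
structure IsDoublyStochastic {n : ℕ} (W : Matrix (Fin n) (Fin n) ℝ) : Prop where
  nonneg : ∀ i j, 0 ≤ W i j
  row_sum : ∀ i, ∑ j, W i j = 1
  col_sum : ∀ j, ∑ i, W i j = 1

/-- The spectral norm of `W - 𝟏𝟏ᵀ/n`. -/
noncomputable def consensusRate {n : ℕ} (W : Matrix (Fin n) (Fin n) ℝ) : ℝ :=
  ‖Matrix.toEuclideanCLM (n := Fin n) (𝕜 := ℝ) (W - Matrix.of fun _ _ => 1 / (n : ℝ))‖

/-- One step `z ↦ z⁺` with stepsize `a`, gradients `Φ i (z i) (y i)` and noise `ε`. In the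
application the vectors are square integrable random vectors, so that `inner` and `‖·‖ ^ 2` carry
the expectations: the noise is orthogonal to what is determined by the past, its components at
different agents are orthogonal, and its size is controlled by that of the gradients. -/
structure IsNoisyStep {n : ℕ} {H H' : Type*} [NormedAddCommGroup H] [InnerProductSpace ℝ H]
    (Φ : Fin n → H → H' → H) (W : Matrix (Fin n) (Fin n) ℝ) (a σ M : ℝ) (zs : H)
    (z : Fin n → H) (y : Fin n → H') (ε z' : Fin n → H) : Prop where
  step : z' = mix W fun j => z j - a • (Φ j (z j) (y j) + ε j)
  orth_past : ∀ i j, inner ℝ (z i - a • Φ i (z i) (y i) - zs) (ε j) = 0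
  orth_noise : ∀ i j, i ≠ j → inner ℝ (ε i) (ε j) = 0
  noise_le : ∀ j, ‖ε j‖ ^ 2 ≤ σ ^ 2 + M * ‖Φ j (z j) (y j)‖ ^ 2

section
variable {H : Type*} [NormedAddCommGroup H] [InnerProductSpace ℝ H]

theorem norm_add_sq_le_two (a b : H) : ‖a + b‖ ^ 2 ≤ 2 * ‖a‖ ^ 2 + 2 * ‖b‖ ^ 2 := by
  have := parallelogram_law_with_norm ℝ a b
  nlinarith [norm_nonneg (a - b)]

theorem norm_add_sq_le_young {E : Type*} [NormedAddCommGroup E] {t : ℝ} (ht : 0 < t) (a b : E) :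
    ‖a + b‖ ^ 2 ≤ (1 + t) * ‖a‖ ^ 2 + (1 + 1 / t) * ‖b‖ ^ 2 := by
  have h1 := pow_le_pow_left₀ (norm_nonneg _) (norm_add_le a b) 2
  have h2 : 2 * ‖a‖ * ‖b‖ ≤ t * ‖a‖ ^ 2 + 1 / t * ‖b‖ ^ 2 := by
    have : 0 ≤ (t * ‖a‖ - ‖b‖) ^ 2 / t := by positivity
    have e : (t * ‖a‖ - ‖b‖) ^ 2 / t = t * ‖a‖ ^ 2 + 1 / t * ‖b‖ ^ 2 - 2 * ‖a‖ * ‖b‖ := by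
      field_simp; ring
    linarith
  nlinarith

/-- Expected one-step descent of a single agent towards a point where the gradient is `b`, the
gradient at the current point being `G` and the variance of the noise `σ² + M ‖G‖²`. -/
theorem norm_sub_smul_sq_add_le {μ L M σ a : ℝ} {e G b : H} (hμ : 0 < μ) (hμL : μ ≤ L)
    (hM : 0 ≤ M) (ha : 0 ≤ a) (haL : 3 * (1 + M) * L ^ 2 * a ≤ μ)
    (hmono : μ * ‖e‖ ^ 2 ≤ inner ℝ (G - b) e) (hlip : ‖G - b‖ ≤ L * ‖e‖) :
    ‖e - a • G‖ ^ 2 + a ^ 2 * (σ ^ 2 + M * ‖G‖ ^ 2)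
      ≤ (1 - a * μ) * ‖e‖ ^ 2 + a / μ * (4 * ‖b‖ ^ 2 + σ ^ 2) := by
  have haμ : a * (1 + M) ≤ 1 / (3 * μ) := by
    rw [le_div_iff₀ (by positivity)]
    have : 3 * (1 + M) * μ ^ 2 * a ≤ μ := by
      refine le_trans ?_ haL
      gcongr
    have h2 : μ * (a * (1 + M) * (3 * μ)) ≤ μ * 1 := by linarith
    exact le_of_mul_le_mul_left h2 hμ
  have haμ' : a ≤ 1 / (3 * μ) := by nlinarith
  have hG : ‖G‖ ^ 2 ≤ 2 * (L * ‖e‖) ^ 2 + 2 * ‖b‖ ^ 2 := by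
    have := norm_add_sq_le_two (G - b) b
    rw [sub_add_cancel] at this
    have h2 := pow_le_pow_left₀ (norm_nonneg _) hlip 2
    linarith
  have t1 : a * (1 + M) * ‖G‖ ^ 2 ≤ 2 / 3 * μ * ‖e‖ ^ 2 + 2 / (3 * μ) * ‖b‖ ^ 2 := by
    calc a * (1 + M) * ‖G‖ ^ 2 ≤ a * (1 + M) * (2 * (L * ‖e‖) ^ 2 + 2 * ‖b‖ ^ 2) := by gcongr
      _ = 2 / 3 * (3 * (1 + M) * L ^ 2 * a) * ‖e‖ ^ 2 + 2 * (a * (1 + M)) * ‖b‖ ^ 2 := by ring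
      _ ≤ 2 / 3 * μ * ‖e‖ ^ 2 + 2 * (1 / (3 * μ)) * ‖b‖ ^ 2 := by gcongr
      _ = _ := by ring
  have hinner : μ * ‖e‖ ^ 2 - ‖b‖ * ‖e‖ ≤ inner ℝ e G := by
    have h1 := abs_le.1 (abs_real_inner_le_norm b e)
    rw [inner_sub_left] at hmono
    rw [real_inner_comm]
    linarith [h1.1]
  have t2 : 2 * (‖b‖ * ‖e‖) ≤ μ / 3 * ‖e‖ ^ 2 + 3 / μ * ‖b‖ ^ 2 := by
    have : 0 ≤ (μ * ‖e‖ - 3 * ‖b‖) ^ 2 / (3 * μ) := by positivity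
    have e' : (μ * ‖e‖ - 3 * ‖b‖) ^ 2 / (3 * μ)
        = μ / 3 * ‖e‖ ^ 2 + 3 / μ * ‖b‖ ^ 2 - 2 * (‖b‖ * ‖e‖) := by
      field_simp; ring
    linarith
  have t3 : a * σ ^ 2 ≤ 1 / μ * σ ^ 2 := by
    gcongr
    refine haμ'.trans ?_
    gcongr
    linarith
  have t4 : 2 / (3 * μ) * ‖b‖ ^ 2 + 3 / μ * ‖b‖ ^ 2 ≤ 4 / μ * ‖b‖ ^ 2 := by
    rw [← add_mul]
    gcongr
    have : 2 / (3 * μ) + 3 / μ = (11 / 3) / μ := by field_simp; norm_num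
    rw [this]
    gcongr
    norm_num
  have key : -2 * inner ℝ e G + a * (1 + M) * ‖G‖ ^ 2 + a * σ ^ 2
      ≤ -(μ * ‖e‖ ^ 2) + (4 / μ * ‖b‖ ^ 2 + 1 / μ * σ ^ 2) := by linarith
  rw [norm_sub_sq_real, real_inner_smul_right, norm_smul, mul_pow, Real.norm_eq_abs, sq_abs]
  calc ‖e‖ ^ 2 - 2 * (a * inner ℝ e G) + a ^ 2 * ‖G‖ ^ 2 + a ^ 2 * (σ ^ 2 + M * ‖G‖ ^ 2)
      = ‖e‖ ^ 2 + a * (-2 * inner ℝ e G + a * (1 + M) * ‖G‖ ^ 2 + a * σ ^ 2) := by ring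
    _ ≤ ‖e‖ ^ 2 + a * (-(μ * ‖e‖ ^ 2) + (4 / μ * ‖b‖ ^ 2 + 1 / μ * σ ^ 2)) := by gcongr
    _ = _ := by ring

end

section
variable {n : ℕ} {H H' : Type*} [NormedAddCommGroup H] [InnerProductSpace ℝ H]
  {Φ : Fin n → H → H' → H} {W : Matrix (Fin n) (Fin n) ℝ} {a σ M N Γ : ℝ} {zs : H}
  {z : Fin n → H} {y : Fin n → H'} {ε z' : Fin n → H}

theorem IsNoisyStep.sum_noise_le (hst : IsNoisyStep Φ W a σ M zs z y ε z') (hM : 0 ≤ M)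
    (hΓ : ∑ i, ‖Φ i (z i) (y i)‖ ^ 2 ≤ Γ * n) :
    ∑ i, ‖ε i‖ ^ 2 ≤ (σ ^ 2 + M * Γ) * n := by
  refine (Finset.sum_le_sum fun j _ => hst.noise_le j).trans ?_
  simp only [Finset.sum_add_distrib, ← Finset.mul_sum, Finset.sum_const, Finset.card_univ,
    Fintype.card_fin, nsmul_eq_mul]
  nlinarith [mul_le_mul_of_nonneg_left hΓ hM]

/-- The consensus error contracts by `ρ = consensusRate W`; Young's
inequality with weight `1 - ρ` leaves `ρ² (2 - ρ) ≤ ρ`. -/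
theorem IsNoisyStep.consensus_le (hst : IsNoisyStep Φ W a σ M zs z y ε z') (hn : 1 ≤ n)
    (hW : IsDoublyStochastic W) (hρ : consensusRate W < 1)
    (hΓ : ∑ i, ‖Φ i (z i) (y i)‖ ^ 2 ≤ Γ * n) (hN : ∑ i, ‖ε i‖ ^ 2 ≤ N * n) :
    ∑ i, ‖z' i - mean z'‖ ^ 2 ≤ consensusRate W * ∑ i, ‖z i - mean z‖ ^ 2
      + a ^ 2 / (1 - consensusRate W) * ((Γ + N) * n) := by
  set ρ := consensusRate W with hρdef
  have hρ0 : 0 ≤ ρ := norm_nonneg _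
  have hδ : 0 < 1 - ρ := by linarith
  set v : Fin n → H := fun j => z j - a • Φ j (z j) (y j) with hv
  have e0 : z' = mix W (fun j => v j - a • ε j) := by
    rw [hst.step]
    congr 1
    funext j
    simp only [hv, smul_add]; abel
  have hmean : mean (fun j => v j - a • ε j) = mean v - a • mean ε := by
    rw [mean_sub, mean_smul]
  have h1 : ∑ i, ‖z' i - mean z'‖ ^ 2
      ≤ ρ ^ 2 * ∑ i, ‖(v i - a • ε i) - (mean v - a • mean ε)‖ ^ 2 := by
    rw [e0, mean_mix hW.col_sum, ← hmean]
    exact sum_norm_mix_sub_mean_sq_le hn hW.row_sum _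
  have horth : ∀ i j, inner ℝ (v i - mean v) (ε j) = 0 := by
    intro i j
    have : v i - mean v = (v i - zs) - mean (fun l => v l - zs) := by
      rw [mean_sub v (fun _ => zs), mean_const hn]; abel
    rw [this, inner_sub_left, hst.orth_past, inner_mean_left,
      Finset.sum_eq_zero (fun l _ => hst.orth_past l j)]
    simp
  have h2 : ∀ i, ‖(v i - a • ε i) - (mean v - a • mean ε)‖ ^ 2
      = ‖v i - mean v‖ ^ 2 + a ^ 2 * ‖ε i - mean ε‖ ^ 2 := by
    intro i
    have : (v i - a • ε i) - (mean v - a • mean ε) = (v i - mean v) - a • (ε i - mean ε) := by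
      rw [smul_sub]; abel
    have h0 : inner ℝ (v i - mean v) (ε i - mean ε) = 0 := by
      rw [inner_sub_right, horth, inner_mean_right,
        Finset.sum_eq_zero (fun l _ => horth i l)]
      simp
    rw [this, norm_sub_sq_real, real_inner_smul_right, h0, norm_smul, mul_pow, Real.norm_eq_abs,
      sq_abs]
    ring
  set G : Fin n → H := fun j => Φ j (z j) (y j) with hG
  have h3 : ∀ i, ‖v i - mean v‖ ^ 2
      ≤ (1 + (1 - ρ)) * ‖z i - mean z‖ ^ 2
        + (1 + 1 / (1 - ρ)) * (a ^ 2 * ‖G i - mean G‖ ^ 2) := by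
    intro i
    have hmv : mean v = mean z - a • mean G := by rw [hv, mean_sub, ← mean_smul]
    have : v i - mean v = (z i - mean z) + (-a) • (G i - mean G) := by
      rw [hmv]
      simp only [hv, hG, neg_smul, smul_sub]
      abel
    rw [this]
    refine (norm_add_sq_le_young hδ _ _).trans_eq ?_
    rw [norm_smul ((-a)), mul_pow, Real.norm_eq_abs, sq_abs, neg_sq]
  have hG2 : ∑ i, ‖G i - mean G‖ ^ 2 ≤ Γ * n := (sum_norm_sub_mean_sq_le hn G).trans hΓ
  have hE2 : ∑ i, ‖ε i - mean ε‖ ^ 2 ≤ N * n := (sum_norm_sub_mean_sq_le hn ε).trans hN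
  have hΓ0 : 0 ≤ Γ * n := le_trans (by positivity) hG2
  have hN0 : 0 ≤ N * n := le_trans (by positivity) hE2
  have h4 : ∑ i, ‖(v i - a • ε i) - (mean v - a • mean ε)‖ ^ 2
      ≤ (1 + (1 - ρ)) * ∑ i, ‖z i - mean z‖ ^ 2
        + (1 + 1 / (1 - ρ)) * (a ^ 2 * (Γ * n)) + a ^ 2 * (N * n) := by
    simp only [h2]
    rw [Finset.sum_add_distrib, ← Finset.mul_sum]
    refine add_le_add ((Finset.sum_le_sum fun j _ => h3 j).trans ?_) ?_
    · simp only [Finset.sum_add_distrib, ← Finset.mul_sum]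
      gcongr
    · gcongr
  have c1 : ρ ^ 2 * (1 + (1 - ρ)) ≤ ρ := by
    nlinarith [mul_nonneg hρ0 hδ.le, mul_nonneg hρ0 (sq_nonneg (1 - ρ))]
  have c2 : ρ ^ 2 * (1 + 1 / (1 - ρ)) ≤ 1 / (1 - ρ) := by
    have : 1 + 1 / (1 - ρ) = (2 - ρ) / (1 - ρ) := by field_simp; ring
    rw [this, ← mul_div_assoc]
    gcongr
    nlinarith [mul_nonneg hρ0 hδ.le, mul_nonneg hρ0 (sq_nonneg (1 - ρ))]
  have c3 : ρ ^ 2 ≤ 1 / (1 - ρ) := by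
    rw [le_div_iff₀ hδ]
    nlinarith [mul_nonneg (sq_nonneg ρ) hρ0]
  have hS : 0 ≤ ∑ i, ‖z i - mean z‖ ^ 2 := by positivity
  calc ∑ i, ‖z' i - mean z'‖ ^ 2
      ≤ ρ ^ 2 * ((1 + (1 - ρ)) * ∑ i, ‖z i - mean z‖ ^ 2
        + (1 + 1 / (1 - ρ)) * (a ^ 2 * (Γ * n)) + a ^ 2 * (N * n)) :=
        h1.trans (mul_le_mul_of_nonneg_left h4 (sq_nonneg ρ))
    _ = ρ ^ 2 * (1 + (1 - ρ)) * ∑ i, ‖z i - mean z‖ ^ 2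
        + ρ ^ 2 * (1 + 1 / (1 - ρ)) * (a ^ 2 * (Γ * n)) + ρ ^ 2 * (a ^ 2 * (N * n)) := by ring
    _ ≤ ρ * ∑ i, ‖z i - mean z‖ ^ 2
        + 1 / (1 - ρ) * (a ^ 2 * (Γ * n)) + 1 / (1 - ρ) * (a ^ 2 * (N * n)) := by gcongr
    _ = _ := by ring

end

section
variable {n : ℕ} {H H' : Type*} [NormedAddCommGroup H] [InnerProductSpace ℝ H]
  [NormedAddCommGroup H'] {Φ : Fin n → H → H' → H} {W : Matrix (Fin n) (Fin n) ℝ}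
  {μ L Λ a σ M B D U N : ℝ} {zs : H} {ys : H'} {z : Fin n → H} {y : Fin n → H'}
  {ε z' : Fin n → H}

theorem IsGradField.norm_sq_le (hΦ : IsGradField Φ μ L Λ) (x xs : H) (v vs : H') (i : Fin n) :
    ‖Φ i x v - Φ i xs vs‖ ^ 2 ≤ 2 * L ^ 2 * ‖x - xs‖ ^ 2 + 2 * Λ ^ 2 * ‖v - vs‖ ^ 2 := by
  have h := norm_add_sq_le_two (Φ i x v - Φ i xs v) (Φ i xs v - Φ i xs vs)
  rw [sub_add_sub_cancel] at h
  have h1 := pow_le_pow_left₀ (norm_nonneg _) (hΦ.lip i v x xs) 2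
  have h2 := pow_le_pow_left₀ (norm_nonneg _) (hΦ.lip_param i xs v vs) 2
  rw [mul_pow] at h1 h2
  linarith

/-- The mean squared error contracts up to a bounded perturbation, uniformly in the network. -/
theorem IsNoisyStep.sum_sq_le (hst : IsNoisyStep Φ W a σ M zs z y ε z')
    (hΦ : IsGradField Φ μ L Λ) (hW : IsDoublyStochastic W) (hμ : 0 < μ) (hμL : μ ≤ L)
    (hM : 0 ≤ M) (ha : 0 ≤ a) (haL : 3 * (1 + M) * L ^ 2 * a ≤ μ)
    (hB : ∑ i, ‖Φ i zs ys‖ ^ 2 ≤ B * n) (hD : ∑ i, ‖y i - ys‖ ^ 2 ≤ D * n) :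
    ∑ i, ‖z' i - zs‖ ^ 2 ≤ (1 - a * μ) * ∑ i, ‖z i - zs‖ ^ 2
      + a * μ * ((8 * Λ ^ 2 * D + 8 * B + σ ^ 2) / μ ^ 2 * n) := by
  have e1 : ∀ i, z' i - zs = mix W (fun j => z j - a • Φ j (z j) (y j) - zs - a • ε j) i := by
    intro i
    have := mix_add (W := W) (fun j => z j - a • Φ j (z j) (y j) - zs - a • ε j) (fun _ => zs) i
    rw [mix_const hW.row_sum] at this
    rw [hst.step, sub_eq_iff_eq_add, ← this]
    congr 1
    funext j
    rw [smul_add]; abel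
  simp only [e1]
  refine (sum_norm_mix_sq_le hW.nonneg hW.row_sum hW.col_sum _).trans ?_
  have e2 : ∀ j, ‖z j - a • Φ j (z j) (y j) - zs - a • ε j‖ ^ 2
      ≤ (1 - a * μ) * ‖z j - zs‖ ^ 2
        + a / μ * (8 * Λ ^ 2 * ‖y j - ys‖ ^ 2 + 8 * ‖Φ j zs ys‖ ^ 2 + σ ^ 2) := by
    intro j
    rw [norm_sub_sq_real, real_inner_smul_right, hst.orth_past, norm_smul, mul_pow,
      Real.norm_eq_abs, sq_abs]
    have h := norm_sub_smul_sq_add_le (σ := σ) hμ hμL hM ha haL (hΦ.mono j (y j) (z j) zs)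
      (hΦ.lip j (y j) (z j) zs)
    have hb : ‖Φ j zs (y j)‖ ^ 2 ≤ 2 * Λ ^ 2 * ‖y j - ys‖ ^ 2 + 2 * ‖Φ j zs ys‖ ^ 2 := by
      have h := norm_add_sq_le_two (Φ j zs (y j) - Φ j zs ys) (Φ j zs ys)
      rw [sub_add_cancel] at h
      have h2 := pow_le_pow_left₀ (norm_nonneg _) (hΦ.lip_param j zs (y j) ys) 2
      rw [mul_pow] at h2
      linarith
    have e : z j - a • Φ j (z j) (y j) - zs = z j - zs - a • Φ j (z j) (y j) := by abel
    rw [e]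
    have h3 : a ^ 2 * ‖ε j‖ ^ 2 ≤ a ^ 2 * (σ ^ 2 + M * ‖Φ j (z j) (y j)‖ ^ 2) := by
      gcongr
      exact hst.noise_le j
    have h4 : a / μ * (4 * ‖Φ j zs (y j)‖ ^ 2 + σ ^ 2)
        ≤ a / μ * (8 * Λ ^ 2 * ‖y j - ys‖ ^ 2 + 8 * ‖Φ j zs ys‖ ^ 2 + σ ^ 2) := by
      gcongr
      linarith
    linarith
  refine (Finset.sum_le_sum fun j _ => e2 j).trans ?_
  simp only [Finset.sum_add_distrib, ← Finset.mul_sum, Finset.sum_const, Finset.card_univ,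
    Fintype.card_fin, nsmul_eq_mul]
  have : a / μ * (8 * Λ ^ 2 * ∑ i, ‖y i - ys‖ ^ 2 + 8 * ∑ i, ‖Φ i zs ys‖ ^ 2 + n * σ ^ 2)
      ≤ a / μ * (8 * Λ ^ 2 * (D * n) + 8 * (B * n) + n * σ ^ 2) := by gcongr
  refine (add_le_add_right this _).trans_eq ?_
  field_simp

theorem IsGradField.sum_norm_sq_le (hΦ : IsGradField Φ μ L Λ)
    (hB : ∑ i, ‖Φ i zs ys‖ ^ 2 ≤ B * n) (hD : ∑ i, ‖y i - ys‖ ^ 2 ≤ D * n)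
    (hU : ∑ i, ‖z i - zs‖ ^ 2 ≤ U * n) :
    ∑ i, ‖Φ i (z i) (y i)‖ ^ 2 ≤ (4 * L ^ 2 * U + 4 * Λ ^ 2 * D + 2 * B) * n := by
  have e : ∀ i, ‖Φ i (z i) (y i)‖ ^ 2
      ≤ 4 * L ^ 2 * ‖z i - zs‖ ^ 2 + 4 * Λ ^ 2 * ‖y i - ys‖ ^ 2 + 2 * ‖Φ i zs ys‖ ^ 2 := by
    intro i
    have h := norm_add_sq_le_two (Φ i (z i) (y i) - Φ i zs ys) (Φ i zs ys)
    rw [sub_add_cancel] at h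
    linarith [hΦ.norm_sq_le (z i) zs (y i) ys i]
  refine (Finset.sum_le_sum fun j _ => e j).trans ?_
  simp only [Finset.sum_add_distrib, ← Finset.mul_sum]
  have : 4 * L ^ 2 * ∑ i, ‖z i - zs‖ ^ 2 + 4 * Λ ^ 2 * ∑ i, ‖y i - ys‖ ^ 2
      + 2 * ∑ i, ‖Φ i zs ys‖ ^ 2 ≤ 4 * L ^ 2 * (U * n) + 4 * Λ ^ 2 * (D * n) + 2 * (B * n) := by
    gcongr
  linarith

/-- The error of the average of the agents contracts as for centralized stochastic gradient
descent: the averaged noise is smaller by the factor `1 / n`, and the perturbation of the gradient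
comes from the consensus error and the parameter error. -/
theorem IsNoisyStep.mean_le (hst : IsNoisyStep Φ W a σ M zs z y ε z') (hn : 1 ≤ n)
    (hΦ : IsGradField Φ μ L Λ) (hW : IsDoublyStochastic W) (hμ : 0 < μ) (hμL : μ ≤ L)
    (ha : 0 < a) (haL : 3 * L ^ 2 * a ≤ μ) (hopt : ∑ i, Φ i zs ys = 0)
    (hN : ∑ i, ‖ε i‖ ^ 2 ≤ N * n) :
    ‖mean z' - zs‖ ^ 2 ≤ (1 - a * μ) * ‖mean z - zs‖ ^ 2
      + 6 * a / μ * (L ^ 2 * ((∑ i, ‖z i - mean z‖ ^ 2) / n)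
        + Λ ^ 2 * ((∑ i, ‖y i - ys‖ ^ 2) / n))
      + a ^ 2 * (N / n) := by
  have hn' : (0 : ℝ) < n := by positivity
  have hL : 0 < L := hμ.trans_le hμL
  have haμ : a * μ ≤ 1 / 3 := by
    have h1 : 3 * μ ^ 2 * a ≤ μ := le_trans (by gcongr) haL
    have h2 : μ * (3 * (a * μ)) ≤ μ * 1 := by linarith
    linarith [le_of_mul_le_mul_left h2 hμ]
  set G : Fin n → H := fun j => Φ j (z j) (y j) with hG
  set v : Fin n → H := fun j => z j - a • G j - zs with hv
  set h : H := mean fun i => Φ i (mean z) ys with hh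
  have e0 : mean z' - zs = (mean z - a • mean G - zs) - a • mean ε := by
    rw [hst.step, mean_mix hW.col_sum, mean_sub, mean_smul, mean_add, smul_add]
    abel
  have hvm : mean z - a • mean G - zs = mean v := by
    rw [hv, mean_sub, mean_const hn, mean_sub, mean_smul]
  have horth : inner ℝ (mean v) (mean ε) = 0 := by
    rw [inner_mean_left]
    simp only [inner_mean_right]
    rw [Finset.sum_eq_zero fun i _ => by
      rw [Finset.sum_eq_zero fun j _ => hst.orth_past i j, mul_zero], mul_zero]
  have h1 : ‖mean z' - zs‖ ^ 2 = ‖mean v‖ ^ 2 + a ^ 2 * ‖mean ε‖ ^ 2 := by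
    rw [e0, hvm, norm_sub_sq_real, real_inner_smul_right, horth, norm_smul, mul_pow,
      Real.norm_eq_abs, sq_abs]
    ring
  have hε : ‖mean ε‖ ^ 2 ≤ N / n := by
    rw [norm_mean_sq_of_orthogonal ε hst.orth_noise]
    gcongr
    rwa [div_le_iff₀ hn']
  -- The average gradient at the average point is strongly monotone around `zs`.
  have hzero : (mean fun i => Φ i zs ys) = 0 := by rw [mean, hopt, smul_zero]
  have hh' : h = mean fun i => Φ i (mean z) ys - Φ i zs ys := by
    rw [mean_sub, hzero, sub_zero]
  have hmono : μ * ‖mean z - zs‖ ^ 2 ≤ inner ℝ (mean z - zs) h := by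
    rw [hh', inner_mean_right, inv_mul_eq_div, le_div_iff₀ hn']
    calc μ * ‖mean z - zs‖ ^ 2 * n = ∑ _i : Fin n, μ * ‖mean z - zs‖ ^ 2 := by
          simp [mul_comm]
      _ ≤ _ := Finset.sum_le_sum fun i _ => by
          rw [real_inner_comm]; exact hΦ.mono i ys (mean z) zs
  have hlip : ‖h‖ ^ 2 ≤ L ^ 2 * ‖mean z - zs‖ ^ 2 := by
    rw [hh']
    refine (norm_mean_sq_le hn _).trans ?_
    rw [div_le_iff₀ hn']
    calc _ ≤ ∑ _i : Fin n, L ^ 2 * ‖mean z - zs‖ ^ 2 := Finset.sum_le_sum fun i _ => by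
          rw [← mul_pow]
          exact pow_le_pow_left₀ (norm_nonneg _) (hΦ.lip i ys (mean z) zs) 2
      _ = _ := by simp [mul_comm]
  have hdiff : ‖h - mean G‖ ^ 2 ≤ 2 * (L ^ 2 * ((∑ i, ‖z i - mean z‖ ^ 2) / n)
        + Λ ^ 2 * ((∑ i, ‖y i - ys‖ ^ 2) / n)) := by
    rw [hh, ← mean_sub]
    refine (norm_mean_sq_le hn _).trans ?_
    rw [div_le_iff₀ hn']
    calc _ ≤ ∑ i : Fin n, (2 * L ^ 2 * ‖z i - mean z‖ ^ 2 + 2 * Λ ^ 2 * ‖y i - ys‖ ^ 2) :=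
          Finset.sum_le_sum fun i _ => by
            rw [norm_sub_rev]; exact hΦ.norm_sq_le (z i) (mean z) (y i) ys i
      _ = _ := by
          rw [Finset.sum_add_distrib, ← Finset.mul_sum, ← Finset.mul_sum]
          field_simp
  have hcontr : ‖mean z - zs - a • h‖ ^ 2 ≤ (1 - 5 / 3 * (a * μ)) * ‖mean z - zs‖ ^ 2 := by
    rw [norm_sub_sq_real, real_inner_smul_right, norm_smul, mul_pow, Real.norm_eq_abs, sq_abs]
    have t1 : a ^ 2 * ‖h‖ ^ 2 ≤ a * μ / 3 * ‖mean z - zs‖ ^ 2 := by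
      calc a ^ 2 * ‖h‖ ^ 2 ≤ a ^ 2 * (L ^ 2 * ‖mean z - zs‖ ^ 2) := by gcongr
        _ = a / 3 * (3 * L ^ 2 * a) * ‖mean z - zs‖ ^ 2 := by ring
        _ ≤ a / 3 * μ * ‖mean z - zs‖ ^ 2 := by gcongr
        _ = _ := by ring
    have t2 := mul_le_mul_of_nonneg_left hmono ha.le
    linarith
  have hy : ‖mean v‖ ^ 2 ≤ (1 + a * μ / 2) * ((1 - 5 / 3 * (a * μ)) * ‖mean z - zs‖ ^ 2)
      + (1 + 1 / (a * μ / 2)) * (a ^ 2 * ‖h - mean G‖ ^ 2) := by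
    have : mean v = (mean z - zs - a • h) + a • (h - mean G) := by
      rw [← hvm, smul_sub]; abel
    rw [this]
    refine (norm_add_sq_le_young (t := a * μ / 2) (by positivity) _ _).trans ?_
    rw [norm_smul a, mul_pow, Real.norm_eq_abs, sq_abs]
    gcongr
  have c1 : (1 + a * μ / 2) * (1 - 5 / 3 * (a * μ)) ≤ 1 - a * μ := by
    nlinarith [mul_pos ha hμ]
  have c2 : (1 + 1 / (a * μ / 2)) * a ^ 2 ≤ 3 * a / μ := by
    have : (1 + 1 / (a * μ / 2)) * a ^ 2 = (a * μ + 2) * a / μ := by field_simp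
    rw [this]
    gcongr
    linarith
  rw [h1]
  refine add_le_add (hy.trans (add_le_add ?_ ?_)) (by gcongr)
  · rw [← mul_assoc]; gcongr
  · rw [← mul_assoc]
    calc (1 + 1 / (a * μ / 2)) * a ^ 2 * ‖h - mean G‖ ^ 2
        ≤ 3 * a / μ * (2 * (L ^ 2 * ((∑ i, ‖z i - mean z‖ ^ 2) / n)
        + Λ ^ 2 * ((∑ i, ‖y i - ys‖ ^ 2) / n))) := by gcongr
      _ = _ := by ring

end

/-- The network-independent convergence rate of distributed stochastic gradient descent with
stepsizes `β / (μ (k + K))`. If the parameter error is bounded by `D` and of order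
`a₁ / (n s) + a₂ / (s² δ²)` with `s = k + K` and `δ = 1 - ρ_w`, then so is the error of the
iterates, with constants that depend on the problem constants only. -/
theorem exists_rate {μ L Λ σ M β B D a₁ a₂ : ℝ} {K : ℕ} (hμ : 0 < μ)
    (hM : 0 ≤ M) (hβ : 2 < β) (hK : 3 * β * (1 + M) * L ^ 2 / μ ^ 2 ≤ K)
    (hB : 0 ≤ B) (hD : 0 ≤ D) (ha₁ : 0 ≤ a₁) (ha₂ : 0 ≤ a₂) :
    ∃ D' b₁ b₂ : ℝ, 0 ≤ D' ∧ 0 ≤ b₁ ∧ 0 ≤ b₂ ∧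
      ∀ {n : ℕ} {H H' : Type*} [NormedAddCommGroup H] [InnerProductSpace ℝ H]
        [NormedAddCommGroup H'] {Φ : Fin n → H → H' → H} {W : Matrix (Fin n) (Fin n) ℝ}
        {zs : H} {ys : H'} {z ε : ℕ → Fin n → H} {y : ℕ → Fin n → H'},
        1 ≤ n → IsGradField Φ μ L Λ → IsDoublyStochastic W → consensusRate W < 1 →
        (∀ k : ℕ, IsNoisyStep Φ W (β / (μ * ((k : ℝ) + K))) σ M zs (z k) (y k) (ε k) (z (k + 1))) →
        ∑ i, Φ i zs ys = 0 → ∑ i, ‖Φ i zs ys‖ ^ 2 ≤ B * n → ∑ i, ‖z 0 i - zs‖ ^ 2 ≤ B * n →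
        (∀ k, ∑ i, ‖y k i - ys‖ ^ 2 ≤ D * n) →
        (∀ k : ℕ, (∑ i, ‖y k i - ys‖ ^ 2) / n
          ≤ a₁ / (n * (k + K)) + a₂ / ((k + K) ^ 2 * (1 - consensusRate W) ^ 2)) →
        (∀ k, ∑ i, ‖z k i - zs‖ ^ 2 ≤ D' * n) ∧
        ∀ k : ℕ, (∑ i, ‖z k i - zs‖ ^ 2) / n
          ≤ b₁ / (n * (k + K)) + b₂ / ((k + K) ^ 2 * (1 - consensusRate W) ^ 2) := by
  rcases lt_or_ge L μ with hLμ | hμL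
  · -- In this case strong monotonicity and Lipschitz continuity leave only the zero space.
    refine ⟨0, 0, 0, le_rfl, le_rfl, le_rfl, ?_⟩
    intro n H H' _ _ _ Φ W zs ys z ε y hn hΦ
    have h0 : ∀ x : H, ‖x - zs‖ ^ 2 = 0 := by
      intro x
      have h1 := hΦ.mono ⟨0, hn⟩ ys x zs
      have h2 := real_inner_le_norm (Φ ⟨0, hn⟩ x ys - Φ ⟨0, hn⟩ zs ys) (x - zs)
      have h3 := mul_le_mul_of_nonneg_right (hΦ.lip ⟨0, hn⟩ ys x zs) (norm_nonneg (x - zs))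
      by_contra hne
      have h4 : 0 < ‖x - zs‖ ^ 2 := lt_of_le_of_ne (sq_nonneg _) (Ne.symm hne)
      nlinarith
    simp [h0]
  have hL : 0 < L := hμ.trans_le hμL
  have hK3 : 3 * β ≤ K := by
    refine le_trans ?_ hK
    rw [le_div_iff₀ (by positivity)]
    have h1 : μ ^ 2 ≤ L ^ 2 := by gcongr
    have h2 : 1 * μ ^ 2 ≤ (1 + M) * L ^ 2 := by
      apply mul_le_mul _ h1 (by positivity) (by positivity)
      linarith
    calc 3 * β * μ ^ 2 = 3 * β * (1 * μ ^ 2) := by ring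
      _ ≤ 3 * β * ((1 + M) * L ^ 2) := by gcongr
      _ = _ := by ring
  have hK1 : (1 : ℝ) ≤ K := by linarith
  obtain ⟨D', hD'⟩ : ∃ D', D' = B + (8 * Λ ^ 2 * D + 8 * B + σ ^ 2) / μ ^ 2 := ⟨_, rfl⟩
  obtain ⟨Γ, hΓ⟩ : ∃ Γ, Γ = 4 * L ^ 2 * D' + 4 * Λ ^ 2 * D + 2 * B := ⟨_, rfl⟩
  obtain ⟨N, hN⟩ : ∃ N, N = σ ^ 2 + M * Γ := ⟨_, rfl⟩
  obtain ⟨A, hA⟩ : ∃ A, A = (25 + (K : ℝ) ^ 2) * (D' + (β / μ) ^ 2 * (Γ + N)) := ⟨_, rfl⟩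
  obtain ⟨c₁, hc₁⟩ : ∃ c, c = 6 * β / μ ^ 2 * (Λ ^ 2 * a₁) + (β / μ) ^ 2 * N := ⟨_, rfl⟩
  obtain ⟨c₂, hc₂⟩ : ∃ c, c = 6 * β / μ ^ 2 * (L ^ 2 * A + Λ ^ 2 * a₂) := ⟨_, rfl⟩
  have hD'0 : 0 ≤ D' := by rw [hD']; positivity
  have hΓ0 : 0 ≤ Γ := by rw [hΓ]; positivity
  have hN0 : 0 ≤ N := by rw [hN]; positivity
  have hA0 : 0 ≤ A := by rw [hA]; positivity
  have hc₁0 : 0 ≤ c₁ := by rw [hc₁]; positivity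
  have hc₂0 : 0 ≤ c₂ := by rw [hc₂]; positivity
  have hβ1 : 0 < β - 1 := by linarith
  have hβ2 : 0 < β - 2 := by linarith
  refine ⟨D', c₁ / (β - 1), c₂ / (β - 2) + K ^ 2 * D' + A, hD'0, by positivity, by positivity, ?_⟩
  intro n H H' _ _ _ Φ W zs ys z ε y hn hΦ hW hρ hst hopt hBΦ hB0 hyD hy
  have hn' : (0 : ℝ) < n := by positivity
  have hρ0 : 0 ≤ consensusRate W := norm_nonneg _
  obtain ⟨δ, hδ⟩ : ∃ δ, δ = 1 - consensusRate W := ⟨_, rfl⟩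
  have hδ0 : 0 < δ := by linarith
  have hδ1 : δ ≤ 1 := by linarith
  rw [← hδ] at hy ⊢
  have hs : ∀ k : ℕ, (K : ℝ) ≤ k + K := fun k => by linarith [Nat.cast_nonneg (α := ℝ) k]
  have hs0 : ∀ k : ℕ, (0 : ℝ) < k + K := fun k => by linarith [hs k]
  have hα : ∀ k : ℕ, 0 < β / (μ * ((k : ℝ) + K)) := fun k => by
    have := hs0 k
    positivity
  have hαμ : ∀ k : ℕ, β / (μ * ((k : ℝ) + K)) * μ = β / (k + K) := fun k => by
    have := hs0 k
    field_simp
  have hαL : ∀ k : ℕ, 3 * (1 + M) * L ^ 2 * (β / (μ * ((k : ℝ) + K))) ≤ μ := fun k => by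
    have h0 := hs0 k
    have h1 := hK.trans (hs k)
    rw [div_le_iff₀ (by positivity)] at h1
    rw [← mul_div_assoc, div_le_iff₀ (by positivity)]
    linarith
  have hαL' : ∀ k : ℕ, 3 * L ^ 2 * (β / (μ * ((k : ℝ) + K))) ≤ μ := fun k => by
    refine le_trans ?_ (hαL k)
    have := (hα k).le
    gcongr
    linarith
  -- The mean squared error is bounded.
  have hU : ∀ k, ∑ i, ‖z k i - zs‖ ^ 2 ≤ D' * n := by
    refine le_of_contraction (t := fun k : ℕ => β / ((k : ℝ) + K)) (fun k => ?_) ?_ fun k => ?_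
    · rw [div_le_one (hs0 k)]
      linarith [hs k]
    · refine hB0.trans ?_
      gcongr
      rw [hD']
      exact le_add_of_nonneg_right (by positivity)
    · have h := (hst k).sum_sq_le hΦ hW hμ hμL hM (hα k).le (hαL k) hBΦ (hyD k)
      rw [hαμ k] at h
      refine h.trans ?_
      have h0 := hs0 k
      gcongr
      rw [hD']
      exact le_add_of_nonneg_left hB
  have hG : ∀ k, ∑ i, ‖Φ i (z k i) (y k i)‖ ^ 2 ≤ Γ * n := fun k => by
    rw [hΓ]
    exact hΦ.sum_norm_sq_le hBΦ (hyD k) (hU k)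
  have hE : ∀ k, ∑ i, ‖ε k i‖ ^ 2 ≤ N * n := fun k => by
    rw [hN]
    exact (hst k).sum_noise_le hM (hG k)
  -- The squared error splits into the consensus error and the error of the average.
  have hsplit : ∀ k, (∑ i, ‖z k i - zs‖ ^ 2) / n
      = ‖mean (z k) - zs‖ ^ 2 + (∑ i, ‖z k i - mean (z k)‖ ^ 2) / n := by
    intro k
    have h := sum_norm_sub_mean_sq hn fun i => z k i - zs
    rw [mean_sub (z k) fun _ => zs, mean_const hn] at h
    simp only [sub_sub_sub_cancel_right] at h
    rw [h]
    field_simp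
    ring
  have hU' : ∀ k, (∑ i, ‖z k i - zs‖ ^ 2) / n ≤ D' := fun k => (div_le_iff₀ hn').2 (hU k)
  have hV : ∀ k : ℕ, (∑ i, ‖z k i - mean (z k)‖ ^ 2) / n ≤ A / ((k + K) ^ 2 * δ ^ 2) := by
    rw [hA]
    refine le_inv_sq_of_contraction hK1 hδ0 hδ1 (by positivity) (fun k => ?_) fun k => ?_
    · have := hU' k
      rw [hsplit k] at this
      have h1 : 0 ≤ (β / μ) ^ 2 * (Γ + N) := by positivity
      linarith [sq_nonneg ‖mean (z k) - zs‖]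
    · have h := (hst k).consensus_le hn hW hρ (hG k) (hE k)
      rw [← hδ] at h
      have e : consensusRate W = 1 - δ := by rw [hδ]; ring
      rw [e] at h
      rw [div_le_iff₀ hn']
      refine h.trans ?_
      have h0 := hs0 k
      calc _ = ((1 - δ) * ((∑ i, ‖z k i - mean (z k)‖ ^ 2) / n)
            + (β / μ) ^ 2 * (Γ + N) / (δ * (k + K) ^ 2)) * n := by field_simp
        _ ≤ _ := by
            gcongr
            exact le_add_of_nonneg_left hD'0
  have hR : ∀ k : ℕ, ‖mean (z k) - zs‖ ^ 2
      ≤ (c₁ / n / (β - 1)) / (k + K) + (c₂ / δ ^ 2 / (β - 2) + K ^ 2 * D' / δ ^ 2) / (k + K) ^ 2 := by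
    refine le_inv_add_inv_sq_of_contraction (a := c₁ / n) (b := c₂ / δ ^ 2) (by linarith) hβ
      (by positivity) (by positivity) (by field_simp; rfl) ?_ ?_ fun k => ?_
    · rw [mul_add, mul_div_cancel₀ _ hβ2.ne']
      exact le_add_of_nonneg_right (by positivity)
    · have h1 := hU' 0
      rw [hsplit 0] at h1
      have h2 : 0 ≤ (∑ i, ‖z 0 i - mean (z 0)‖ ^ 2) / n := by positivity
      have hKp : (0 : ℝ) < K := by linarith
      have h3 : D' ≤ K ^ 2 * D' / δ ^ 2 / K ^ 2 := by
        have : (K : ℝ) ^ 2 * D' / δ ^ 2 / K ^ 2 = D' / δ ^ 2 := by field_simp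
        rw [this, le_div_iff₀ (by positivity)]
        exact mul_le_of_le_one_right hD'0 (pow_le_one₀ hδ0.le hδ1)
      have h4 : 0 ≤ c₁ / n / (β - 1) / K := by positivity
      have h5 : 0 ≤ c₂ / δ ^ 2 / (β - 2) / K ^ 2 := by positivity
      rw [add_div]
      linarith
    · have h0 := hs0 k
      refine ((hst k).mean_le hn hΦ hW hμ hμL (hα k) (hαL' k) hopt (hE k)).trans ?_
      rw [hαμ k, add_assoc, add_assoc]
      refine add_le_add_right ?_ _
      have h1 := hV k
      have h2 := hy k
      calc _ ≤ 6 * (β / (μ * ((k : ℝ) + K))) / μ * (L ^ 2 * (A / ((k + K) ^ 2 * δ ^ 2))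
            + Λ ^ 2 * (a₁ / (n * (k + K)) + a₂ / ((k + K) ^ 2 * δ ^ 2)))
            + (β / (μ * ((k : ℝ) + K))) ^ 2 * (N / n) := by
            have := hα k
            gcongr
        _ = _ := by
            rw [hc₁, hc₂]
            field_simp
            ring
  refine ⟨hU, fun k => ?_⟩
  rw [hsplit k]
  have h0 := hs0 k
  refine (add_le_add (hR k) (hV k)).trans_eq ?_
  field_simp
  ring

/-! ### Orthogonality of the noise -/

section
variable {Ω : Type*} {mΩ : MeasurableSpace Ω} {P : Measure Ω} {E : Type*} [NormedAddCommGroup E]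
  [InnerProductSpace ℝ E]

theorem inner_toLp_toLp {f g : Ω → E} (hf : MemLp f 2 P) (hg : MemLp g 2 P) :
    inner ℝ (hf.toLp f) (hg.toLp g) = ∫ ω, inner ℝ (f ω) (g ω) ∂P := by
  rw [L2.inner_def]
  refine integral_congr_ae ?_
  filter_upwards [hf.coeFn_toLp, hg.coeFn_toLp] with ω h1 h2
  rw [h1, h2]

theorem norm_toLp_sq {f : Ω → E} (hf : MemLp f 2 P) :
    ‖hf.toLp f‖ ^ 2 = ∫ ω, ‖f ω‖ ^ 2 ∂P := by
  rw [← real_inner_self_eq_norm_sq, inner_toLp_toLp]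
  simp only [real_inner_self_eq_norm_sq]

theorem integrable_inner_of_memLp {f g : Ω → E} (hf : MemLp f 2 P) (hg : MemLp g 2 P) :
    Integrable (fun ω => inner ℝ (f ω) (g ω)) P := by
  refine (L2.integrable_inner (𝕜 := ℝ) (hf.toLp f) (hg.toLp g)).congr ?_
  filter_upwards [hf.coeFn_toLp, hg.coeFn_toLp] with ω h1 h2
  rw [h1, h2]

theorem norm_sub_sq_eq_integral (u v : Lp E 2 P) : ‖u - v‖ ^ 2 = ∫ ω, ‖u ω - v ω‖ ^ 2 ∂P := by
  rw [← real_inner_self_eq_norm_sq, L2.inner_def]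
  refine integral_congr_ae ?_
  filter_upwards [Lp.coeFn_sub u v] with ω h
  rw [real_inner_self_eq_norm_sq, h, Pi.sub_apply]

theorem memLp_mix {n : ℕ} (W : Matrix (Fin n) (Fin n) ℝ) {v : Fin n → Ω → E} (hv : ∀ j, MemLp (v j) 2 P)
    (i : Fin n) : MemLp (fun ω => mix W (fun j => v j ω) i) 2 P :=
  memLp_finsetSum _ fun j _ => (hv j).const_smul (W i j)

theorem mix_toLp {n : ℕ} (W : Matrix (Fin n) (Fin n) ℝ) {v : Fin n → Ω → E} (hv : ∀ j, MemLp (v j) 2 P)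
    (i : Fin n) : mix W (fun j => (hv j).toLp (v j)) i = (memLp_mix W hv i).toLp _ := by
  have key : ∀ s : Finset (Fin n), ∑ j ∈ s, W i j • (hv j).toLp (v j)
      = (memLp_finsetSum s fun j _ => (hv j).const_smul (W i j) :
          MemLp (fun ω => ∑ j ∈ s, W i j • v j ω) 2 P).toLp _ := by
    intro s
    induction s using Finset.induction_on with
    | empty => exact (MemLp.toLp_zero _).symm
    | insert j s hj ih =>
      rw [Finset.sum_insert hj, ih, ← MemLp.toLp_const_smul, ← MemLp.toLp_add]
      rw [MemLp.toLp_eq_toLp_iff]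
      exact Filter.Eventually.of_forall fun ω =>
        (Finset.sum_insert (f := fun j => W i j • v j ω) hj).symm
  exact key Finset.univ

/-- A square integrable random vector minus its conditional expectation is orthogonal to every
square integrable random vector that is measurable with respect to the conditioning. -/
theorem integral_inner_eq_zero_of_condExp [CompleteSpace E] [IsFiniteMeasure P]
    {m : MeasurableSpace Ω} (hm : m ≤ mΩ) {Y s G : Ω → E} (hYm : StronglyMeasurable[m] Y)
    (hY : MemLp Y 2 P) (hs : MemLp s 2 P) (hGm : StronglyMeasurable[m] G) (hG : MemLp G 2 P)
    (h : P[s | m] =ᵐ[P] G) :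
    ∫ ω, inner ℝ (Y ω) (s ω - G ω) ∂P = 0 := by
  have h0 : P[s - G | m] =ᵐ[P] 0 := by
    filter_upwards [condExp_sub (hs.integrable one_le_two) (hG.integrable one_le_two) m, h]
      with ω h1 h2
    rw [h1, condExp_of_stronglyMeasurable hm hGm (hG.integrable one_le_two), Pi.sub_apply, h2]
    simp
  have h1 := condExp_bilin_of_stronglyMeasurable_left (m := m) (innerSL ℝ) hYm
    (integrable_inner_of_memLp hY (hs.sub hG)) ((hs.sub hG).integrable one_le_two)
  have h2 := integral_condExp (μ := P) hm (f := fun ω => inner ℝ (Y ω) ((s - G) ω))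
  refine h2.symm.trans ?_
  rw [← integral_zero Ω ℝ]
  refine integral_congr_ae ?_
  filter_upwards [h1, h0] with ω h3 h4
  refine h3.trans ?_
  rw [h4]
  simp

/-- If `η` is independent of `ξ`, and the pair `(ξ, η)` is independent of `X`, then `η` is
independent of `(X, ξ)`. -/
theorem indepFun_prodMk_of_indepFun [IsProbabilityMeasure P] {S A A' : Type*} [MeasurableSpace S]
    [MeasurableSpace A] [MeasurableSpace A'] {X : Ω → S} {ξ : Ω → A} {η : Ω → A'}
    (hX : Measurable X) (hξ : Measurable ξ) (hη : Measurable η) (h : IndepFun ξ η P)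
    (h' : IndepFun X (fun ω => (ξ ω, η ω)) P) :
    IndepFun (fun ω => (X ω, ξ ω)) η P := by
  have hXξ : IndepFun X ξ P := h'.comp measurable_id measurable_fst
  rw [indepFun_iff_map_prod_eq_prod_map_map (by fun_prop) (by fun_prop)] at h h' hXξ ⊢
  have := Measure.isProbabilityMeasure_map (μ := P) hX.aemeasurable
  have := Measure.isProbabilityMeasure_map (μ := P) hξ.aemeasurable
  have := Measure.isProbabilityMeasure_map (μ := P) hη.aemeasurable
  rw [hXξ, ← MeasurableEquiv.prodAssoc.map_measurableEquiv_injective.eq_iff,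
    Measure.prodAssoc_prod, ← h, ← h',
    Measure.map_map MeasurableEquiv.prodAssoc.measurable (by fun_prop)]
  rfl

/-- Two noise vectors formed from a common state `X` and samples `ξ`, `η`, the latter being
independent of `(X, ξ)`, are orthogonal if the second one has zero mean given `X`: for almost
every value `x` of `X` the integral of `ψ (x, ·)` vanishes. -/
theorem integral_inner_eq_zero_of_indepFun [CompleteSpace E] [MeasurableSpace E] [BorelSpace E]
    [SecondCountableTopology E] [IsProbabilityMeasure P] {S A A' : Type*} [MeasurableSpace S]
    [MeasurableSpace A] [MeasurableSpace A'] {X : Ω → S} {ξ : Ω → A} {η : Ω → A'}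
    (hX : Measurable X) (hξ : Measurable ξ) (hη : Measurable η)
    (hind : IndepFun (fun ω => (X ω, ξ ω)) η P) {φ : S × A → E} {ψ : S × A' → E}
    (hφ : Measurable φ) (hψ : Measurable ψ) (hφ2 : MemLp (fun ω => φ (X ω, ξ ω)) 2 P)
    (hψ2 : MemLp (fun ω => ψ (X ω, η ω)) 2 P)
    (h0 : ∀ T, MeasurableSet T → ∫ ω in X ⁻¹' T, ψ (X ω, η ω) ∂P = 0) :
    ∫ ω, inner ℝ (φ (X ω, ξ ω)) (ψ (X ω, η ω)) ∂P = 0 := by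
  have hpX := Measure.isProbabilityMeasure_map (μ := P) hX.aemeasurable
  have hpη := Measure.isProbabilityMeasure_map (μ := P) hη.aemeasurable
  have hXη : IndepFun X η P := hind.comp measurable_fst measurable_id
  rw [indepFun_iff_map_prod_eq_prod_map_map hX.aemeasurable hη.aemeasurable] at hXη
  rw [indepFun_iff_map_prod_eq_prod_map_map (hX.prodMk hξ).aemeasurable hη.aemeasurable] at hind
  have hψi : Integrable ψ ((P.map X).prod (P.map η)) := by
    rw [← hXη]
    exact (integrable_map_measure hψ.aestronglyMeasurable (by fun_prop)).2
      (hψ2.integrable one_le_two)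
  have hF : (fun x => ∫ b, ψ (x, b) ∂P.map η) =ᵐ[P.map X] 0 := by
    refine hψi.integral_prod_left.ae_eq_zero_of_forall_setIntegral_eq_zero fun T hT _ => ?_
    have h1 := setIntegral_prod ψ (s := T) (t := Set.univ) (μ := P.map X) (ν := P.map η)
      hψi.integrableOn
    simp only [Measure.restrict_univ] at h1
    rw [← h1, ← hXη, setIntegral_map (hT.prod MeasurableSet.univ) hψ.aestronglyMeasurable
      (hX.prodMk hη).aemeasurable, ← h0 T hT]
    congr 2
    ext ω
    simp
  have hae : ∀ᵐ ω ∂P, ∫ b, ψ (X ω, b) ∂P.map η = 0 := ae_of_ae_map hX.aemeasurable hF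
  have haei : ∀ᵐ ω ∂P, Integrable (fun b => ψ (X ω, b)) (P.map η) :=
    ae_of_ae_map hX.aemeasurable hψi.prod_right_ae
  have hm : Measurable fun z : (S × A) × A' => (inner ℝ (φ z.1) (ψ (z.1.1, z.2)) : ℝ) := by
    fun_prop
  have hi := integrable_inner_of_memLp hφ2 hψ2
  have e1 : ∫ ω, inner ℝ (φ (X ω, ξ ω)) (ψ (X ω, η ω)) ∂P
      = ∫ z, (inner ℝ (φ z.1) (ψ (z.1.1, z.2)) : ℝ) ∂P.map fun ω => ((X ω, ξ ω), η ω) :=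
    (integral_map (f := fun z : (S × A) × A' => (inner ℝ (φ z.1) (ψ (z.1.1, z.2)) : ℝ))
      ((hX.prodMk hξ).prodMk hη).aemeasurable hm.aestronglyMeasurable).symm
  rw [e1, hind, integral_prod]
  · have hm2 : Measurable fun z : S × A =>
        ∫ b, (inner ℝ (φ z) (ψ (z.1, b)) : ℝ) ∂P.map η :=
      (hm.stronglyMeasurable.integral_prod_right' (ν := P.map η)).measurable
    rw [integral_map (hX.prodMk hξ).aemeasurable hm2.aestronglyMeasurable, ← integral_zero Ω ℝ]
    refine integral_congr_ae ?_
    filter_upwards [hae, haei] with ω h1 h2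
    rw [integral_inner h2, h1, inner_zero_right]
  · rw [← hind]
    exact (integrable_map_measure hm.aestronglyMeasurable
      ((hX.prodMk hξ).prodMk hη).aemeasurable).2 hi

end

/-! ### Gradient fields acting on square integrable random vectors -/

section
variable {Ω : Type*} {mΩ : MeasurableSpace Ω} {P : Measure Ω} [IsProbabilityMeasure P]
  {n : ℕ} {E F : Type*} [NormedAddCommGroup E] [InnerProductSpace ℝ E] [NormedAddCommGroup F]
  {Φ : Fin n → E → F → E} {μ L Λ : ℝ}

theorem IsGradField.continuous (hΦ : IsGradField Φ μ L Λ) (i : Fin n) :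
    Continuous fun p : E × F => Φ i p.1 p.2 := by
  rw [continuous_iff_continuousAt]
  rintro ⟨x, v⟩
  refine tendsto_iff_norm_sub_tendsto_zero.2 ?_
  have hlim : Filter.Tendsto (fun p : E × F => L * ‖p.1 - x‖ + Λ * ‖p.2 - v‖) (nhds (x, v))
      (nhds 0) := by
    have : Continuous fun p : E × F => L * ‖p.1 - x‖ + Λ * ‖p.2 - v‖ := by fun_prop
    simpa using this.tendsto (x, v)
  refine squeeze_zero (fun _ => norm_nonneg _) (fun p => ?_) hlim
  have h := norm_add_le (Φ i p.1 p.2 - Φ i x p.2) (Φ i x p.2 - Φ i x v)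
  rw [sub_add_sub_cancel] at h
  exact h.trans (add_le_add (hΦ.lip i _ _ _) (hΦ.lip_param i _ _ _))

theorem IsGradField.memLp (hΦ : IsGradField Φ μ L Λ) (i : Fin n) {u : Ω → E} {v : Ω → F}
    (hu : MemLp u 2 P) (hv : MemLp v 2 P) : MemLp (fun ω => Φ i (u ω) (v ω)) 2 P := by
  have hbound : MemLp (fun ω => L * ‖u ω‖ + Λ * ‖v ω‖ + ‖Φ i 0 0‖) 2 P :=
    ((hu.norm.const_mul L).add (hv.norm.const_mul Λ)).add (memLp_const _)
  refine hbound.mono ((hΦ.continuous i).comp_aestronglyMeasurable₂ hu.1 hv.1)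
    (Filter.Eventually.of_forall fun ω => ?_)
  refine le_trans ?_ (Real.le_norm_self _)
  have h1 := norm_add₃_le (a := Φ i (u ω) (v ω) - Φ i 0 (v ω)) (b := Φ i 0 (v ω) - Φ i 0 0)
    (c := Φ i 0 0)
  have h2 := hΦ.lip i (v ω) (u ω) 0
  have h3 := hΦ.lip_param i 0 (v ω) 0
  rw [sub_zero] at h2 h3
  rw [sub_add_sub_cancel, sub_add_cancel] at h1
  linarith

/-- The superposition operators `(u, v) ↦ Φ i (u ω) (v ω)` of a family of gradient fields on square
integrable random vectors. -/
noncomputable def IsGradField.superpose (hΦ : IsGradField Φ μ L Λ) (P : Measure Ω)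
    [IsProbabilityMeasure P] (i : Fin n) (u : Lp E 2 P) (v : Lp F 2 P) : Lp E 2 P :=
  (hΦ.memLp i (Lp.memLp u) (Lp.memLp v)).toLp _

theorem IsGradField.coeFn_superpose (hΦ : IsGradField Φ μ L Λ) (i : Fin n) (u : Lp E 2 P)
    (v : Lp F 2 P) : hΦ.superpose P i u v =ᵐ[P] fun ω => Φ i (u ω) (v ω) :=
  MemLp.coeFn_toLp _

theorem IsGradField.superpose_toLp (hΦ : IsGradField Φ μ L Λ) (i : Fin n) {u : Ω → E} {v : Ω → F}
    (hu : MemLp u 2 P) (hv : MemLp v 2 P) :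
    hΦ.superpose P i (hu.toLp u) (hv.toLp v) = (hΦ.memLp i hu hv).toLp _ := by
  rw [IsGradField.superpose, MemLp.toLp_eq_toLp_iff]
  filter_upwards [hu.coeFn_toLp, hv.coeFn_toLp] with ω h1 h2
  rw [h1, h2]

theorem IsGradField.isGradField_superpose (hΦ : IsGradField Φ μ L Λ) :
    IsGradField (hΦ.superpose P) μ L Λ where
  mono i v u' u := by
    rw [norm_sub_sq_eq_integral, ← integral_const_mul, L2.inner_def]
    have hint : Integrable (fun ω => ‖u' ω - u ω‖ ^ 2) P :=
      ((Lp.memLp u').sub (Lp.memLp u)).integrable_norm_pow two_ne_zero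
    refine integral_mono_ae (hint.const_mul μ) (L2.integrable_inner _ _) ?_
    filter_upwards [Lp.coeFn_sub u' u, Lp.coeFn_sub (hΦ.superpose P i u' v) (hΦ.superpose P i u v),
      hΦ.coeFn_superpose i u' v, hΦ.coeFn_superpose i u v] with ω h1 h2 h3 h4
    rw [h1, h2, Pi.sub_apply, Pi.sub_apply, h3, h4]
    exact hΦ.mono i _ _ _
  lip i v u' u := by
    refine Lp.norm_le_mul_norm_of_ae_le_mul ?_
    filter_upwards [Lp.coeFn_sub u' u, Lp.coeFn_sub (hΦ.superpose P i u' v) (hΦ.superpose P i u v),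
      hΦ.coeFn_superpose i u' v, hΦ.coeFn_superpose i u v] with ω h1 h2 h3 h4
    rw [h1, h2, Pi.sub_apply, Pi.sub_apply, h3, h4]
    exact hΦ.lip i _ _ _
  lip_param i u v' v := by
    refine Lp.norm_le_mul_norm_of_ae_le_mul ?_
    filter_upwards [Lp.coeFn_sub v' v, Lp.coeFn_sub (hΦ.superpose P i u v') (hΦ.superpose P i u v),
      hΦ.coeFn_superpose i u v', hΦ.coeFn_superpose i u v] with ω h1 h2 h3 h4
    rw [h1, h2, Pi.sub_apply, Pi.sub_apply, h3, h4]
    exact hΦ.lip_param i _ _ _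

/-- A run of distributed stochastic gradient descent with stepsizes `α k`: stochastic gradients `s`
at the iterates `z`, whose errors are centred given the past (`orth_past`), uncorrelated between
agents (`orth_noise`) and of controlled variance, for gradient fields `Φ` with random parameters
`y`. -/
structure IsStochasticRun (P : Measure Ω) (Φ : Fin n → E → F → E) (W : Matrix (Fin n) (Fin n) ℝ)
    (α : ℕ → ℝ) (σ M : ℝ) (zs : E) (z s : ℕ → Fin n → Ω → E) (y : ℕ → Fin n → Ω → F) : Prop where
  memLp_z : ∀ k i, MemLp (z k i) 2 P
  memLp_s : ∀ k i, MemLp (s k i) 2 P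
  memLp_y : ∀ k i, MemLp (y k i) 2 P
  step : ∀ k i ω, z (k + 1) i ω = mix W (fun j => z k j ω - α k • s k j ω) i
  orth_past : ∀ k i j, ∫ ω, inner ℝ (z k i ω - α k • Φ i (z k i ω) (y k i ω) - zs)
    (s k j ω - Φ j (z k j ω) (y k j ω)) ∂P = 0
  orth_noise : ∀ k i j, i ≠ j → ∫ ω, inner ℝ (s k i ω - Φ i (z k i ω) (y k i ω))
    (s k j ω - Φ j (z k j ω) (y k j ω)) ∂P = 0
  noise_le : ∀ k j, ∫ ω, ‖s k j ω - Φ j (z k j ω) (y k j ω)‖ ^ 2 ∂P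
    ≤ σ ^ 2 + M * ∫ ω, ‖Φ j (z k j ω) (y k j ω)‖ ^ 2 ∂P

/-- The steps of a stochastic run are noisy steps in the Hilbert space of square integrable random
vectors. -/
theorem IsStochasticRun.isNoisyStep {W : Matrix (Fin n) (Fin n) ℝ} {α : ℕ → ℝ} {σ M : ℝ} {zs : E}
    {z s : ℕ → Fin n → Ω → E} {y : ℕ → Fin n → Ω → F}
    (h : IsStochasticRun P Φ W α σ M zs z s y) (hΦ : IsGradField Φ μ L Λ) (k : ℕ) :
    IsNoisyStep (hΦ.superpose P) W (α k) σ M (Lp.const 2 P zs)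
      (fun i => (h.memLp_z k i).toLp _) (fun i => (h.memLp_y k i).toLp _)
      (fun i => ((h.memLp_s k i).sub (hΦ.memLp i (h.memLp_z k i) (h.memLp_y k i))).toLp _)
      (fun i => (h.memLp_z (k + 1) i).toLp _) where
  step := by
    have e : ∀ j, (h.memLp_z k j).toLp (z k j) - α k • (hΦ.superpose P j
        ((h.memLp_z k j).toLp (z k j)) ((h.memLp_y k j).toLp (y k j))
        + ((h.memLp_s k j).sub (hΦ.memLp j (h.memLp_z k j) (h.memLp_y k j))).toLp _)
        = ((h.memLp_z k j).sub ((h.memLp_s k j).const_smul (α k))).toLp _ := by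
      intro j
      rw [hΦ.superpose_toLp, MemLp.toLp_sub (h.memLp_s k j)
        (hΦ.memLp j (h.memLp_z k j) (h.memLp_y k j)), add_sub_cancel, ← MemLp.toLp_const_smul,
        ← MemLp.toLp_sub]
    simp only [e]
    funext i
    rw [mix_toLp W fun j => (h.memLp_z k j).sub ((h.memLp_s k j).const_smul (α k)),
      MemLp.toLp_eq_toLp_iff]
    exact Filter.Eventually.of_forall fun ω => h.step k i ω
  orth_past i j := by
    rw [hΦ.superpose_toLp, ← MemLp.toLp_const, ← MemLp.toLp_const_smul, ← MemLp.toLp_sub,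
      ← MemLp.toLp_sub, inner_toLp_toLp]
    exact h.orth_past k i j
  orth_noise i j hij := by
    rw [inner_toLp_toLp]
    exact h.orth_noise k i j hij
  noise_le j := by
    rw [hΦ.superpose_toLp, norm_toLp_sq, norm_toLp_sq]
    exact h.noise_le k j

end

/-- `exists_rate` for random vectors: the conclusion bounds `∑ E‖z_i(k) - z_*‖²`. -/
theorem exists_rate_integral {μ L Λ σ M β B D a₁ a₂ : ℝ} {K : ℕ} (hμ : 0 < μ)
    (hM : 0 ≤ M) (hβ : 2 < β) (hK : 3 * β * (1 + M) * L ^ 2 / μ ^ 2 ≤ K)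
    (hB : 0 ≤ B) (hD : 0 ≤ D) (ha₁ : 0 ≤ a₁) (ha₂ : 0 ≤ a₂) :
    ∃ D' b₁ b₂ : ℝ, 0 ≤ D' ∧ 0 ≤ b₁ ∧ 0 ≤ b₂ ∧
      ∀ {n : ℕ} {Ω E F : Type*} [MeasurableSpace Ω] {P : Measure Ω} [IsProbabilityMeasure P]
        [NormedAddCommGroup E] [InnerProductSpace ℝ E] [NormedAddCommGroup F] [InnerProductSpace ℝ F]
        {Φ : Fin n → E → F → E} {W : Matrix (Fin n) (Fin n) ℝ} {zs : E} {ys : F}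
        {z s : ℕ → Fin n → Ω → E} {y : ℕ → Fin n → Ω → F},
        1 ≤ n → IsGradField Φ μ L Λ → IsDoublyStochastic W → consensusRate W < 1 →
        IsStochasticRun P Φ W (fun k => β / (μ * ((k : ℝ) + K))) σ M zs z s y →
        ∑ i, Φ i zs ys = 0 → ∑ i, ‖Φ i zs ys‖ ^ 2 ≤ B * n →
        ∑ i, ∫ ω, ‖z 0 i ω - zs‖ ^ 2 ∂P ≤ B * n →
        (∀ k, ∑ i, ∫ ω, ‖y k i ω - ys‖ ^ 2 ∂P ≤ D * n) →
        (∀ k : ℕ, (∑ i, ∫ ω, ‖y k i ω - ys‖ ^ 2 ∂P) / n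
          ≤ a₁ / (n * (k + K)) + a₂ / ((k + K) ^ 2 * (1 - consensusRate W) ^ 2)) →
        (∀ k, ∑ i, ∫ ω, ‖z k i ω - zs‖ ^ 2 ∂P ≤ D' * n) ∧
        ∀ k : ℕ, (∑ i, ∫ ω, ‖z k i ω - zs‖ ^ 2 ∂P) / n
          ≤ b₁ / (n * (k + K)) + b₂ / ((k + K) ^ 2 * (1 - consensusRate W) ^ 2) := by
  obtain ⟨D', b₁, b₂, hD', hb₁, hb₂, hrate⟩ :=
    exists_rate (Λ := Λ) (σ := σ) hμ hM hβ hK hB hD ha₁ ha₂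
  refine ⟨D', b₁, b₂, hD', hb₁, hb₂, ?_⟩
  intro n Ω E F _ P _ _ _ _ _ Φ W zs ys z s y hn hΦ hW hρ hrun hopt hBΦ hB0 hyD hyr
  have ez : ∀ k i, ‖(hrun.memLp_z k i).toLp (z k i) - Lp.const 2 P zs‖ ^ 2
      = ∫ ω, ‖z k i ω - zs‖ ^ 2 ∂P := fun k i => by
    rw [← MemLp.toLp_const, ← MemLp.toLp_sub, norm_toLp_sq]
    rfl
  have ey : ∀ k i, ‖(hrun.memLp_y k i).toLp (y k i) - Lp.const 2 P ys‖ ^ 2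
      = ∫ ω, ‖y k i ω - ys‖ ^ 2 ∂P := fun k i => by
    rw [← MemLp.toLp_const, ← MemLp.toLp_sub, norm_toLp_sq]
    rfl
  have eΦ : ∀ i, hΦ.superpose P i (Lp.const 2 P zs) (Lp.const 2 P ys)
      = Lp.const 2 P (Φ i zs ys) := fun i => by
    rw [← MemLp.toLp_const, ← MemLp.toLp_const, hΦ.superpose_toLp]
    rfl
  have h := hrate hn (hΦ.isGradField_superpose (P := P)) hW hρ (zs := Lp.const 2 P zs)
    (ys := Lp.const 2 P ys) (fun k => hrun.isNoisyStep hΦ k)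
    (by simp only [eΦ]; rw [← map_sum, hopt, map_zero])
    (by
      refine le_trans (le_of_eq (Finset.sum_congr rfl fun i _ => ?_)) hBΦ
      rw [eΦ, Lp.norm_const' _ _ _ two_ne_zero ENNReal.ofNat_ne_top]
      simp)
    (by simpa only [ez] using hB0) (by simpa only [ey] using hyD) (by simpa only [ey] using hyr)
  simpa only [ez] using h

/-! ### Noise of a stochastic gradient oracle with fresh samples -/

section
variable {Ω : Type*} {m mΩ : MeasurableSpace Ω} {P : Measure Ω} [IsProbabilityMeasure P]
  {E : Type*} [NormedAddCommGroup E]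

theorem integral_norm_sq_le_of_condExp (hm : m ≤ mΩ) {s G : Ω → E}
    {σ M : ℝ} (hG : MemLp G 2 P)
    (h : P[fun ω => ‖s ω - G ω‖ ^ 2 | m] ≤ᵐ[P] fun ω => σ ^ 2 + M * ‖G ω‖ ^ 2) :
    ∫ ω, ‖s ω - G ω‖ ^ 2 ∂P ≤ σ ^ 2 + M * ∫ ω, ‖G ω‖ ^ 2 ∂P := by
  have hi : Integrable (fun ω => M * ‖G ω‖ ^ 2) P :=
    (hG.integrable_norm_pow two_ne_zero).const_mul M
  rw [← integral_condExp hm]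
  refine (integral_mono_ae integrable_condExp ((integrable_const _).add hi) h).trans_eq ?_
  simp only [Pi.add_apply]
  rw [integral_add (integrable_const _) hi, integral_const_mul]
  simp

/-- Unbiased oracles fed with a common state and independent fresh samples at the agents have
orthogonal errors. -/
theorem integral_inner_oracle_eq_zero [InnerProductSpace ℝ E] [CompleteSpace E] [MeasurableSpace E]
    [BorelSpace E] [SecondCountableTopology E] {n : ℕ} (hm : m ≤ mΩ)
    {S A : Type*} [MeasurableSpace S] [MeasurableSpace A] {X : Ω → S} (hX : Measurable[m] X)
    {ξ : Fin n → Ω → A} (hξ : ∀ i, Measurable (ξ i)) (hind : iIndepFun ξ P)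
    (hfresh : Indep (MeasurableSpace.comap (fun ω i => ξ i ω) inferInstance) m P)
    {o : Fin n → S × A → E} {G : Fin n → S → E} (ho : ∀ i, Measurable (o i))
    (hG : ∀ i, Measurable (G i)) (ho2 : ∀ i, MemLp (fun ω => o i (X ω, ξ i ω)) 2 P)
    (hG2 : ∀ i, MemLp (fun ω => G i (X ω)) 2 P)
    (h : ∀ i, P[fun ω => o i (X ω, ξ i ω) | m] =ᵐ[P] fun ω => G i (X ω)) {i j : Fin n}
    (hij : i ≠ j) :
    ∫ ω, inner ℝ (o i (X ω, ξ i ω) - G i (X ω)) (o j (X ω, ξ j ω) - G j (X ω)) ∂P = 0 := by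
  have hX' : Measurable X := hX.mono hm le_rfl
  have hpair : IndepFun X (fun ω => (ξ i ω, ξ j ω)) P := by
    rw [IndepFun_iff_Indep]
    refine (indep_of_indep_of_le_left (indep_of_indep_of_le_right hfresh hX.comap_le) ?_).symm
    have : Measurable fun v : Fin n → A => (v i, v j) := by fun_prop
    exact (this.comp (comap_measurable fun ω i => ξ i ω)).comap_le
  refine integral_inner_eq_zero_of_indepFun (φ := fun z => o i z - G i z.1)
    (ψ := fun z => o j z - G j z.1) hX' (hξ i) (hξ j)
    (indepFun_prodMk_of_indepFun hX' (hξ i) (hξ j) (hind.indepFun hij) hpair)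
    ((ho i).sub ((hG i).comp measurable_fst)) ((ho j).sub ((hG j).comp measurable_fst))
    ((ho2 i).sub (hG2 i)) ((ho2 j).sub (hG2 j)) fun T hT => ?_
  have hT' : MeasurableSet[m] (X ⁻¹' T) := hX hT
  have hoi := (ho2 j).integrable one_le_two
  rw [integral_sub hoi.integrableOn ((hG2 j).integrable one_le_two).integrableOn,
    ← setIntegral_condExp hm hoi hT', sub_eq_zero]
  refine setIntegral_congr_ae (hm _ hT') ?_
  filter_upwards [h j] with ω hω _ using hω

end

/-- At a minimizer of the average of differentiable functions the gradients sum to zero. -/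
theorem sum_gradient_eq_zero {n : ℕ} (hn : 1 ≤ n) {E : Type*} [NormedAddCommGroup E]
    [InnerProductSpace ℝ E] [CompleteSpace E] {f : Fin n → E → ℝ}
    (hf : ∀ i, Differentiable ℝ (f i)) {xs : E}
    (h : ∀ x, (1 / (n : ℝ)) * ∑ i, f i xs ≤ (1 / (n : ℝ)) * ∑ i, f i x) :
    ∑ i, gradient (f i) xs = 0 := by
  have hn' : (0 : ℝ) < 1 / n := by positivity
  have hmin : IsLocalMin (fun x => ∑ i, f i x) xs :=
    Filter.Eventually.of_forall fun x => le_of_mul_le_mul_left (h x) hn'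
  have hd : HasFDerivAt (fun x => ∑ i, f i x)
      (∑ i, InnerProductSpace.toDual ℝ E (gradient (f i) xs)) xs :=
    HasFDerivAt.fun_sum fun i _ => ((hf i) xs).hasGradientAt.hasFDerivAt
  have h0 := hmin.hasFDerivAt_eq_zero hd
  rw [← map_sum] at h0
  exact (map_eq_zero_iff _ (InnerProductSpace.toDual ℝ E).injective).1 h0

/-! ### The coupled algorithm -/

namespace Data

variable {n p q d m : ℕ} {Ω : Type*} {D : Data n p q d m Ω} {c : Constants}

theorem FunctionAssumption.isGradField_gradF (h : D.FunctionAssumption c) :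
    IsGradField D.gradF c.muX c.LX c.LXT :=
  ⟨h.strong_f, h.smooth_f, h.lip_f⟩

/-- The learning gradients as gradient fields with a parameter (in `ℝ`) that is not used. -/
theorem FunctionAssumption.isGradField_gradH (h : D.FunctionAssumption c) :
    IsGradField (fun i θ (_ : ℝ) => D.gradH i θ) c.muT c.LT 0 :=
  ⟨fun i _ => h.strong_h i, fun i _ => h.smooth_h i, fun i x _ _ => by simp⟩

theorem measurable_iter_hist (D : Data n p q d m Ω) (c : Constants) (k : ℕ) :
    Measurable[D.hist c k] (D.iter c k) :=
  (comap_measurable _).mono (le_iSup₂_of_le k le_rfl le_rfl) le_rfl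

theorem x_succ (k : ℕ) (i : Fin n) (ω : Ω) :
    D.x c i (k + 1) ω = mix D.W (fun j => D.x c j k ω - c.stepX k • D.stochX c j k ω) i := rfl

theorem θ_succ (k : ℕ) (i : Fin n) (ω : Ω) :
    D.θ c i (k + 1) ω = mix D.W (fun j => D.θ c j k ω - c.stepT k • D.stochT c j k ω) i := rfl

variable [MeasurableSpace Ω] {P : Measure Ω}

theorem SamplingAssumption.measurable_iter (h : D.SamplingAssumption c P) (k : ℕ) :
    Measurable (D.iter c k) := by
  induction k with
  | zero => exact measurable_const
  | succ k ih =>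
    have hx : ∀ j, Measurable fun ω => (D.iter c k ω).1 j := fun j => by fun_prop
    have hθ : ∀ j, Measurable fun ω => (D.iter c k ω).2 j := fun j => by fun_prop
    refine Measurable.prodMk (measurable_pi_lambda _ fun i => ?_)
      (measurable_pi_lambda _ fun i => ?_)
    · exact Finset.measurable_fun_sum _ fun j _ => ((hx j).sub (((h.meas_g j).comp
        ((hx j).prodMk ((hθ j).prodMk (h.meas_ξ j k)))).const_smul (c.stepX k))).const_smul (D.W i j)
    · exact Finset.measurable_fun_sum _ fun j _ => ((hθ j).sub (((h.meas_φ j).comp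
        ((hθ j).prodMk (h.meas_ζ j k))).const_smul (c.stepT k))).const_smul (D.W i j)

theorem SamplingAssumption.hist_le (h : D.SamplingAssumption c P) (k : ℕ) :
    D.hist c k ≤ ‹MeasurableSpace Ω› :=
  iSup₂_le fun j _ => (h.measurable_iter j).comap_le

variable [IsProbabilityMeasure P]

theorem MomentAssumption.memLp_iter_x (h : D.MomentAssumption c P) (k : ℕ) (i : Fin n) :
    MemLp (D.x c i k) 2 P := by
  induction k generalizing i with
  | zero => exact memLp_const _
  | succ k ih =>
    have e : D.x c i (k + 1) = fun ω =>
        mix D.W (fun j => D.x c j k ω - c.stepX k • D.stochX c j k ω) i := rfl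
    rw [e]
    exact memLp_mix D.W (v := fun j ω => D.x c j k ω - c.stepX k • D.stochX c j k ω)
      (fun j => (ih j).sub ((h.memLp_x j k).const_smul (c.stepX k))) i

theorem MomentAssumption.memLp_iter_θ (h : D.MomentAssumption c P) (k : ℕ) (i : Fin n) :
    MemLp (D.θ c i k) 2 P := by
  induction k generalizing i with
  | zero => exact memLp_const _
  | succ k ih =>
    have e : D.θ c i (k + 1) = fun ω =>
        mix D.W (fun j => D.θ c j k ω - c.stepT k • D.stochT c j k ω) i := rfl
    rw [e]
    exact memLp_mix D.W (v := fun j ω => D.θ c j k ω - c.stepT k • D.stochT c j k ω)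
      (fun j => (ih j).sub ((h.memLp_t j k).const_smul (c.stepT k))) i

theorem isStochasticRun_x (hF : D.FunctionAssumption c) (hS : D.SamplingAssumption c P)
    (hM : D.MomentAssumption c P) (xs : Vec p) :
    IsStochasticRun P D.gradF D.W c.stepX c.sigX c.MX xs (fun k i => D.x c i k)
      (fun k i => D.stochX c i k) fun k i => D.θ c i k := by
  have hΦ := hF.isGradField_gradF
  have hcF : ∀ i, Measurable fun z : Vec p × Vec q => D.gradF i z.1 z.2 := fun i =>
    (hΦ.continuous i).measurable
  have hG : ∀ i k, MemLp (fun ω => D.gradF i (D.x c i k ω) (D.θ c i k ω)) 2 P := fun i k =>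
    hΦ.memLp i (hM.memLp_iter_x k i) (hM.memLp_iter_θ k i)
  have hx : ∀ i k, Measurable[D.hist c k] (D.x c i k) := fun i k =>
    (measurable_pi_apply i).comp (measurable_fst.comp (D.measurable_iter_hist c k))
  have hθ : ∀ i k, Measurable[D.hist c k] (D.θ c i k) := fun i k =>
    (measurable_pi_apply i).comp (measurable_snd.comp (D.measurable_iter_hist c k))
  have hmG : ∀ i k, Measurable[D.hist c k] fun ω => D.gradF i (D.x c i k ω) (D.θ c i k ω) :=
    fun i k => (hcF i).comp ((hx i k).prodMk (hθ i k))
  exact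
  { memLp_z := fun k i => hM.memLp_iter_x k i
    memLp_s := fun k i => hM.memLp_x i k
    memLp_y := fun k i => hM.memLp_iter_θ k i
    step := fun k i ω => D.x_succ k i ω
    orth_past := fun k i j => integral_inner_eq_zero_of_condExp (hS.hist_le k)
      (((hx i k).sub ((hmG i k).const_smul (c.stepX k))).sub measurable_const).stronglyMeasurable
      (((hM.memLp_iter_x k i).sub ((hG i k).const_smul (c.stepX k))).sub (memLp_const xs))
      (hM.memLp_x j k) (hmG j k).stronglyMeasurable (hG j k) (hM.unbiased_x j k)
    orth_noise := fun k i j hij => integral_inner_oracle_eq_zero (hS.hist_le k)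
      (D.measurable_iter_hist c k) (fun i => hS.meas_ξ i k) (hS.indep_ξ k) (hS.fresh_ξ k)
      (o := fun i z => D.g i (z.1.1 i) (z.1.2 i) z.2) (G := fun i z => D.gradF i (z.1 i) (z.2 i))
      (fun i => (hS.meas_g i).comp (f := fun z : ((Fin n → Vec p) × (Fin n → Vec q)) × Vec d =>
        (z.1.1 i, z.1.2 i, z.2)) (by fun_prop))
      (fun i => (hcF i).comp (f := fun z : (Fin n → Vec p) × (Fin n → Vec q) =>
        (z.1 i, z.2 i)) (by fun_prop))
      (fun i => hM.memLp_x i k) (fun i => hG i k) (fun i => hM.unbiased_x i k) hij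
    noise_le := fun k j =>
      integral_norm_sq_le_of_condExp (hS.hist_le k) (hG j k) (hM.variance_x j k) }

theorem isStochasticRun_θ (hF : D.FunctionAssumption c) (hS : D.SamplingAssumption c P)
    (hM : D.MomentAssumption c P) (θs : Vec q) :
    IsStochasticRun P (fun i θ (_ : ℝ) => D.gradH i θ) D.W c.stepT c.sigT c.MT θs
      (fun k i => D.θ c i k) (fun k i => D.stochT c i k) fun _ _ _ => 0 := by
  have hΦ := hF.isGradField_gradH
  have hcH : ∀ i, Measurable (D.gradH i) := fun i =>
    ((hΦ.continuous i).comp (Continuous.prodMk_left (0 : ℝ))).measurable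
  have hG : ∀ i k, MemLp (fun ω => D.gradH i (D.θ c i k ω)) 2 P := fun i k =>
    hΦ.memLp i (v := fun _ => 0) (hM.memLp_iter_θ k i) (memLp_const 0)
  have hθ : ∀ i k, Measurable[D.hist c k] (D.θ c i k) := fun i k =>
    (measurable_pi_apply i).comp (measurable_snd.comp (D.measurable_iter_hist c k))
  have hmG : ∀ i k, Measurable[D.hist c k] fun ω => D.gradH i (D.θ c i k ω) :=
    fun i k => (hcH i).comp (hθ i k)
  exact
  { memLp_z := fun k i => hM.memLp_iter_θ k i
    memLp_s := fun k i => hM.memLp_t i k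
    memLp_y := fun _ _ => memLp_const 0
    step := fun k i ω => D.θ_succ k i ω
    orth_past := fun k i j => integral_inner_eq_zero_of_condExp (hS.hist_le k)
      (((hθ i k).sub ((hmG i k).const_smul (c.stepT k))).sub measurable_const).stronglyMeasurable
      (((hM.memLp_iter_θ k i).sub ((hG i k).const_smul (c.stepT k))).sub (memLp_const θs))
      (hM.memLp_t j k) (hmG j k).stronglyMeasurable (hG j k) (hM.unbiased_t j k)
    orth_noise := fun k i j hij => integral_inner_oracle_eq_zero (hS.hist_le k)
      (D.measurable_iter_hist c k) (fun i => hS.meas_ζ i k) (hS.indep_ζ k) (hS.fresh_ζ k)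
      (o := fun i z => D.φ i (z.1.2 i) z.2) (G := fun i z => D.gradH i (z.2 i))
      (fun i => (hS.meas_φ i).comp (f := fun z : ((Fin n → Vec p) × (Fin n → Vec q)) × Vec m =>
        (z.1.2 i, z.2)) (by fun_prop))
      (fun i => (hcH i).comp (f := fun z : (Fin n → Vec p) × (Fin n → Vec q) => z.2 i)
        (by fun_prop))
      (fun i => hM.memLp_t i k) (fun i => hG i k) (fun i => hM.unbiased_t i k) hij
    noise_le := fun k j =>
      integral_norm_sq_le_of_condExp (hS.hist_le k) (hG j k) (hM.variance_t j k) }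

end Data

end CDSA

theorem theorem4p2 (c : CDSA.Constants) (hc : c.Admissible) (B : ℝ) :
    ∃ CT C₁ : ℝ, 0 < CT ∧ 0 < C₁ ∧
      ∀ (n p q d m : ℕ) (_ : 1 ≤ n) (Ω : Type*) [MeasurableSpace Ω] (P : Measure Ω)
        [IsProbabilityMeasure P] (D : CDSA.Data n p q d m Ω)
        (xs : CDSA.Vec p) (θs : CDSA.Vec q),
        D.FunctionAssumption c → D.SamplingAssumption c P → D.MomentAssumption c P →
        D.NetworkAssumption → D.rho < 1 →
        D.IsOptimal xs θs → D.LinearBounds xs θs B →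
        ∃ KT : ℕ, 1 ≤ KT ∧ (KT : ℝ) ≤ CT * (n / (1 - D.rho) ^ 2) ∧
          ∀ k : ℕ, KT ≤ k →
            (∀ i, Integrable (fun ω => ‖D.x c i k ω - xs‖ ^ 2) P) ∧
            D.mse c P xs k ≤ C₁ * D.rate c xs θs k := by
  have hβ := hc.two_lt_beta
  have hμx := hc.muX_pos
  have hσ := hc.sigX_pos
  obtain ⟨DT, t₁, t₂, hDT, ht₁, ht₂, hT⟩ := CDSA.exists_rate_integral (μ := c.muT) (L := c.LT)
    (Λ := 0) (σ := c.sigT) (M := c.MT) (β := c.beta) (B := |B|) (D := 0) (a₁ := 0) (a₂ := 0)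
    (K := c.shift) hc.muT_pos hc.MT_pos.le hβ ((le_max_right _ _).trans (Nat.le_ceil _))
    (abs_nonneg B) le_rfl le_rfl le_rfl
  obtain ⟨DX, b₁, b₂, hDX, hb₁, hb₂, hX⟩ := CDSA.exists_rate_integral (μ := c.muX) (L := c.LX)
    (Λ := c.LXT) (σ := c.sigX) (M := c.MX) (β := c.beta) (B := |B|) (D := DT) (a₁ := t₁) (a₂ := t₂)
    (K := c.shift) hc.muX_pos hc.MX_pos.le hβ ((le_max_left _ _).trans (Nat.le_ceil _))
    (abs_nonneg B) hDT ht₁ ht₂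
  have hβ1 : 0 < 2 * c.beta - 1 := by linarith
  have hβ0 : 0 < c.beta := by linarith
  refine ⟨2, (b₁ + b₂ + 1) * ((2 * c.beta - 1) * c.muX ^ 2 / (c.beta ^ 2 * c.sigX ^ 2)),
    two_pos, by positivity, ?_⟩
  intro n p q d m hn Ω _ P _ D xs θs hF hS hM hN hρ hO hL
  have hn' : (0 : ℝ) < n := by positivity
  have hB : ∀ {r : ℝ}, r ≤ B * n → r ≤ |B| * n := fun h =>
    h.trans (mul_le_mul_of_nonneg_right (le_abs_self B) hn'.le)
  have hW : CDSA.IsDoublyStochastic D.W := ⟨hN.nonneg, hN.row_sum, hN.col_sum⟩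
  obtain ⟨hT1, hT2⟩ := hT hn hF.isGradField_gradH hW hρ (CDSA.Data.isStochasticRun_θ hF hS hM θs)
    (CDSA.sum_gradient_eq_zero hn hF.diff_h hO.min_h) (hB hL.heter_t)
    (by simpa [CDSA.Data.θ, CDSA.Data.iter] using hB hL.init_t) (ys := 0) (by simp) (by simp)
  obtain ⟨-, hX2⟩ := hX hn hF.isGradField_gradF hW hρ (CDSA.Data.isStochasticRun_x hF hS hM xs)
    (CDSA.sum_gradient_eq_zero hn (fun i => hF.diff_f i θs) hO.min_f) (hB hL.heter_x)
    (by simpa [CDSA.Data.x, CDSA.Data.iter] using hB hL.init_x) hT1 hT2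
  have hδ : 0 < 1 - D.rho := by linarith
  have hδ1 : 1 - D.rho ≤ 1 := by
    have : 0 ≤ D.rho := norm_nonneg _
    linarith
  have hone : 1 ≤ n / (1 - D.rho) ^ 2 := by
    rw [le_div_iff₀ (by positivity), one_mul]
    exact (pow_le_one₀ hδ.le hδ1).trans (by exact_mod_cast hn)
  refine ⟨⌈n / (1 - D.rho) ^ 2⌉₊, Nat.one_le_ceil_iff.2 (by linarith), ?_, fun k hk => ⟨fun i =>
    ((hM.memLp_iter_x k i).sub (memLp_const xs)).integrable_norm_pow two_ne_zero, ?_⟩⟩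
  · have := Nat.ceil_lt_add_one (zero_le_one.trans hone)
    linarith
  have hkr : n / (1 - D.rho) ^ 2 ≤ k := Nat.ceil_le.1 hk
  have hk0 : (0 : ℝ) < k := by linarith
  have hM0 : c.sigX ^ 2 ≤ D.Mbar c xs θs := by
    have := hc.MX_pos
    exact le_add_of_nonneg_left (by positivity)
  have hsk : (k : ℝ) ≤ k + c.shift := by simp
  -- From the transient time on the network term is dominated by the centralized one.
  calc D.mse c P xs k = (∑ i, ∫ ω, ‖D.x c i k ω - xs‖ ^ 2 ∂P) / n := by
        rw [CDSA.Data.mse, one_div, inv_mul_eq_div]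
    _ ≤ b₁ / (n * (k + c.shift)) + b₂ / ((k + c.shift) ^ 2 * (1 - D.rho) ^ 2) := hX2 k
    _ ≤ b₁ / (n * k) + b₂ / (k ^ 2 * (1 - D.rho) ^ 2) := by gcongr
    _ ≤ b₁ / (n * k) + b₂ / (n * k) := by
        refine add_le_add_right (div_le_div_of_nonneg_left hb₂ (by positivity) ?_) _
        rw [div_le_iff₀ (by positivity)] at hkr
        calc (n : ℝ) * k ≤ k * (1 - D.rho) ^ 2 * k := by gcongr
          _ = _ := by ring
    _ ≤ (b₁ + b₂ + 1) / (n * k) * 1 := by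
        rw [← add_div, mul_one]
        exact div_le_div_of_nonneg_right (by linarith) (by positivity)
    _ ≤ (b₁ + b₂ + 1) / (n * k) * (D.Mbar c xs θs / c.sigX ^ 2) := by
        gcongr
        rwa [one_le_div (by positivity)]
    _ = _ := by
        rw [CDSA.Data.rate]
        field_simp
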